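/- Let $\Bbbk$ be an algebraically closed field, $H$ a Hopf algebra over $\Bbbk$ that is finitely generated as an algebra, and $C\subseteq H$ a central Hopf subalgebra such that $H$ is a finitely generated $C$-module. Let $\mathfrak m_{\bar\varepsilon}\subset C$ be the kernel of the counit of $C$, so that the identity fiber $H/\mathfrak m_{\bar\varepsilon}H$ is a finite dimensional Hopf algebra, and let $G_0$ be the group of its characters (algebra homomorphisms $H/\mathfrak m_{\bar\varepsilon}H\to\Bbbk$) under convolution. Write $\operatorname{Irr}(A)$ for the set of isomorphism classes of irreducible modules of an algebra $A$, and identify a character with the corresponding one-dimensional module. Modules of the fibers $H/\mathfrak mH$ are viewed as $H$-modules, tensor products are tensor products of $H$-modules, and $V^*$ is the dual vector space of $V$ with $\langle h\xi,v\rangle=\langle \xi,S(h)v\rangle$, where $S$ is the antipode. Then for every maximal ideal $\mathfrak m$ of $C$ the following hold. (a) For all $V,W\in\operatorname{Irr}(H/\mathfrak mH)$ there are $M',M''\in\operatorname{Irr}(H/\mathfrak m_{\bar\varepsilon}H)$ such that $W$ is a quotient of $M'\otimes V$ and a submodule of $M''\otimes V$. (b) $G_0$ embeds in $\operatorname{Irr}(H/\mathfrak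 m_{\bar\varepsilon}H)$, and $G_0$ acts on $\operatorname{Irr}(H/\mathfrak mH)$ by $V\mapsto\chi\otimes V$ for $\chi\in G_0$. (c) For every $V\in\operatorname{Irr}(H/\mathfrak mH)$, the group $\operatorname{Stab}_{G_0}(V)=\{\chi\in G_0 : \chi\otimes V\cong V\}$ satisfies $|\operatorname{Stab}_{G_0}(V)|\le\dim(V)^2$. (d) For $V\in\operatorname{Irr}(H/\mathfrak mH)$ the following are equivalent: (i) $|\operatorname{Stab}_{G_0}(V)|=\dim(V)^2$ (then $V$ is called maximally stable); (ii) $V\otimes V^*$ is a direct sum of pairwise nonisomorphic one-dimensional $H$-modules; (iii) $V\otimes V^*\cong\bigoplus_{\chi\in\operatorname{Stab}_{G_0}(V)}\chi$. (e) Let $V\in\operatorname{Irr}(H/\mathfrak mH)$. For each $\chi\in\operatorname{Stab}_{G_0}(V)$ there is an isomorphism of $H$-modules $L_\chi:V\to\chi^{-1}\otimes V$; identify the vector space $\chi^{-1}\otimes V$ with $V$. For every choice of such $L_\chi$ there is a unique 2-cocycle $\gamma_V:\operatorname{Stab}_{G_0}(V)\times\operatorname{Stab}_{G_0}(V)\to\Bbbk^*$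 with $L_\chi L_\theta=\gamma_V(\chi,\theta)L_{\chi\theta}$ for all $\chi,\theta$. If $V$ is maximally stable, then the algebra $H/\operatorname{Ann}_H(V)$, the twisted group algebra $\Bbbk_{\gamma_V}\operatorname{Stab}_{G_0}(V)$ (with basis $\operatorname{Stab}_{G_0}(V)$ and product $\chi\cdot\theta=\gamma_V(\chi,\theta)\,\chi\theta$) and $\operatorname{End}_\Bbbk(V)$ are isomorphic algebras. (f) If the identity fiber $H/\mathfrak m_{\bar\varepsilon}H$ is a basic algebra (its quotient by the Jacobson radical is a product of copies of $\Bbbk$), then the embedding of $G_0$ in $\operatorname{Irr}(H/\mathfrak m_{\bar\varepsilon}H)$ in (b) is a bijection, and the action of $G_0$ on the nonempty set $\operatorname{Irr}(H/\mathfrak mH)$ is transitive. -/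

import Mathlib

open scoped TensorProduct

universe u v w w₁ w₂

noncomputable section

/-! ### Modules over a `k`-algebra, as `k`-vector spaces with an action -/

/-- A (left) module over a `k`-algebra `A`: a `k`-vector space together with a homomorphism of
`k`-algebras from `A` to its endomorphism algebra. -/
structure AlgModule (k : Type u) (A : Type v) [Field k] [Ring A] [Algebra k A] where
  /-- The underlying vector space. -/
  carrier : Type w
  [addCommGroup : AddCommGroup carrier]
  [module : Module k carrier]
  /-- The action. -/
  act : A →ₐ[k] Module.End k carrier

namespace AlgModule

attribute [instance] AlgModule.addCommGroup AlgModule.module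

section Basic

variable {k : Type u} {A : Type v} [Field k] [Ring A] [Algebra k A]

instance : CoeSort (AlgModule.{u, v, w} k A) (Type w) := ⟨AlgModule.carrier⟩

/-- The dimension over `k`. -/
def dim (M : AlgModule.{u, v, w} k A) : ℕ := Module.finrank k M

/-- `A`-linearity of a `k`-linear map between `A`-modules. -/
def IsHom {M : AlgModule.{u, v, w₁} k A} {N : AlgModule.{u, v, w₂} k A} (f : M →ₗ[k] N) : Prop :=
  ∀ (a : A) (x : M), f (M.act a x) = N.act a (f x)

/-- The two `A`-modules are isomorphic. -/
def Iso (M : AlgModule.{u, v, w₁} k A) (N : AlgModule.{u, v, w₂} k A) : Prop :=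
  ∃ e : M ≃ₗ[k] N, IsHom e.toLinearMap

/-- `N` is (isomorphic to) a quotient of `M`. -/
def IsQuotientOf (N : AlgModule.{u, v, w₂} k A) (M : AlgModule.{u, v, w₁} k A) : Prop :=
  ∃ f : M →ₗ[k] N, IsHom f ∧ Function.Surjective f

/-- `N` is (isomorphic to) a submodule of `M`. -/
def IsSubmoduleOf (N : AlgModule.{u, v, w₂} k A) (M : AlgModule.{u, v, w₁} k A) : Prop :=
  ∃ f : N →ₗ[k] M, IsHom f ∧ Function.Injective f

/-- Irreducible modules, that is, simple modules in the sense of Mathlib. -/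
def IsIrreducible (M : AlgModule.{u, v, w} k A) : Prop :=
  letI : Module A M := Module.compHom M M.act.toRingHom
  IsSimpleModule A M

/-- The annihilator, a two-sided ideal. -/
def annihilator (M : AlgModule.{u, v, w} k A) : Ideal A := RingHom.ker M.act

instance (M : AlgModule.{u, v, w} k A) : M.annihilator.IsTwoSided :=
  inferInstanceAs (RingHom.ker M.act).IsTwoSided

/-- Restriction of scalars along a homomorphism of algebras. -/
def restrict {B : Type w₁} [Ring B] [Algebra k B] (f : A →ₐ[k] B) (M : AlgModule.{u, w₁, w} k B) :
    AlgModule.{u, v, w} k A where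
  carrier := M
  act := M.act.comp f

/-- The one-dimensional module given by a character of `A`. -/
def ofCharacter (χ : A →ₐ[k] k) : AlgModule.{u, v, u} k A where
  carrier := k
  act := (Algebra.lmul k k).comp χ

/-- The direct sum of a family of modules. -/
def directSum {ι : Type w₁} (M : ι → AlgModule.{u, v, w} k A) :
    AlgModule.{u, v, max w₁ w} k A where
  carrier := DirectSum ι fun i => M i
  act :=
    { toFun := fun a => DirectSum.lmap fun i => (M i).act a
      map_one' := by ext x i; simp
      map_mul' := fun a b => by ext x i; simp
      map_zero' := by ext x i; simp
      map_add' := fun a b => by ext x i; simp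
      commutes' := fun r => by
        ext x i
        simp only [AlgHom.commutes, DirectSum.lmap_apply, Module.algebraMap_end_apply]
        rfl }

theorem Iso.refl (M : AlgModule.{u, v, w} k A) : M.Iso M :=
  ⟨LinearEquiv.refl k M, fun _ _ => rfl⟩

theorem Iso.symm {M : AlgModule.{u, v, w₁} k A} {N : AlgModule.{u, v, w₂} k A} (h : M.Iso N) :
    N.Iso M := by
  obtain ⟨e, he⟩ := h
  refine ⟨e.symm, fun a y => ?_⟩
  apply e.injective
  have := he a (e.symm y)
  simp only [LinearEquiv.coe_coe, LinearEquiv.apply_symm_apply] at this ⊢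
  exact this.symm

theorem Iso.trans {M : AlgModule.{u, v, w} k A} {N : AlgModule.{u, v, w₁} k A}
    {P : AlgModule.{u, v, w₂} k A} (h : M.Iso N) (h' : N.Iso P) : M.Iso P := by
  obtain ⟨e, he⟩ := h
  obtain ⟨e', he'⟩ := h'
  refine ⟨e.trans e', fun a x => ?_⟩
  have h1 := he a x
  have h2 := he' a (e x)
  simp only [LinearEquiv.coe_coe] at h1 h2
  simp only [LinearEquiv.coe_coe, LinearEquiv.trans_apply]
  rw [h1, h2]

end Basic

section Hopf

variable {k : Type u} {H : Type v} [Field k] [Ring H] [HopfAlgebra k H]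

/-- The tensor product of modules over a Hopf algebra: `h` acts by `∑ h₁ ⊗ h₂`. -/
def tensor (M : AlgModule.{u, v, w₁} k H) (N : AlgModule.{u, v, w₂} k H) :
    AlgModule.{u, v, max w₁ w₂} k H where
  carrier := M ⊗[k] N
  act := (Module.endTensorEndAlgHom (R := k) (S := k) (A := k)).comp
    ((Algebra.TensorProduct.map M.act N.act).comp (Bialgebra.comulAlgHom k H))

/-- The (left) dual `V*`: the dual vector space with `⟨h ξ, x⟩ = ⟨ξ, S(h) x⟩`. -/
def dual (M : AlgModule.{u, v, w} k H) : AlgModule.{u, v, max u w} k H where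
  carrier := Module.Dual k M
  act :=
    { toFun := fun h => (M.act (HopfAlgebra.antipode k h)).dualMap
      map_one' := by ext ξ x; simp
      map_mul' := fun a b => by
        ext ξ x; simp [HopfAlgebra.antipode_mul_antidistrib]
      map_zero' := by ext ξ x; simp
      map_add' := fun a b => by ext ξ x; simp
      commutes' := fun r => by
        ext ξ x; simp [Algebra.algebraMap_eq_smul_one] }

end Hopf

end AlgModule

/-! ### Isomorphism classes of irreducible modules -/

/-- The irreducible modules of `A`. Each of them is a quotient of `A`, so that the universe of the
carriers contains a representative of every isomorphism class. -/
abbrev IrrModule (k : Type u) (A : Type v) [Field k] [Ring A] [Algebra k A] :=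
  {M : AlgModule.{u, v, max u v} k A // M.IsIrreducible}

/-- Isomorphism of irreducible modules. -/
instance irrSetoid (k : Type u) (A : Type v) [Field k] [Ring A] [Algebra k A] :
    Setoid (IrrModule k A) where
  r M N := M.1.Iso N.1
  iseqv := ⟨fun M => .refl M.1, fun h => h.symm, fun h h' => h.trans h'⟩

/-- `Irr(A)`, the set of isomorphism classes of irreducible modules of `A`. -/
def Irr (k : Type u) (A : Type v) [Field k] [Ring A] [Algebra k A] : Type _ :=
  Quotient (irrSetoid k A)

/-- The isomorphism class of an irreducible module. -/
def IrrModule.cls {k : Type u} {A : Type v} [Field k] [Ring A] [Algebra k A]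
    (M : IrrModule k A) : Irr k A :=
  Quotient.mk _ M

/-- A finite dimensional algebra `A` over an algebraically closed field is basic if the quotient
by its Jacobson radical is a product of copies of the field. -/
def IsBasicAlgebra (k : Type u) (A : Type v) [Field k] [Ring A] [Algebra k A] : Prop :=
  Module.Finite k A ∧ ∃ n : ℕ, Nonempty ((A ⧸ Ring.jacobson A) ≃ₐ[k] (Fin n → k))

/-! ### The group of characters of a Hopf algebra -/

/-- The group `G(A°)` of group-like elements of the finite dual of a Hopf algebra `A`: the
characters of `A` under the convolution product `(χ ψ)(a) = ∑ χ(a₁) ψ(a₂)`. -/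
def CharGroup (k : Type u) (A : Type v) [Field k] [Ring A] [HopfAlgebra k A] : Type _ :=
  WithConv (A →ₐ[k] k)

namespace CharGroup

variable {k : Type u} {A : Type v} [Field k] [Ring A] [HopfAlgebra k A]

/-- The underlying character. -/
def toAlgHom (χ : CharGroup k A) : A →ₐ[k] k := WithConv.ofConv χ

instance : Monoid (CharGroup k A) := inferInstanceAs (Monoid (WithConv (A →ₐ[k] k)))

/-- The inverse of a character `χ` is `χ ∘ S`. -/
instance : Inv (CharGroup k A) where
  inv χ := WithConv.toConv
    (AlgHom.ofLinearMap (χ.toAlgHom.toLinearMap ∘ₗ HopfAlgebra.antipode k)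
      (by simp) (fun a b => by simp [HopfAlgebra.antipode_mul_antidistrib, mul_comm]))

theorem inv_apply (χ : CharGroup k A) (a : A) :
    (χ⁻¹).toAlgHom a = χ.toAlgHom (HopfAlgebra.antipode k a) := rfl

theorem one_apply (a : A) :
    (1 : CharGroup k A).toAlgHom a = Coalgebra.counit (R := k) a := rfl

theorem mul_apply (χ ψ : CharGroup k A) (a : A) :
    (χ * ψ).toAlgHom a = LinearMap.mul' k k
      (TensorProduct.map χ.toAlgHom.toLinearMap ψ.toAlgHom.toLinearMap
        (Coalgebra.comul (R := k) a)) := rfl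

theorem ext' {χ ψ : CharGroup k A} (h : ∀ a, χ.toAlgHom a = ψ.toAlgHom a) : χ = ψ :=
  WithConv.ofConv_injective (AlgHom.ext h)

instance : Group (CharGroup k A) :=
  { (inferInstance : Monoid (CharGroup k A)), (inferInstance : Inv (CharGroup k A)) with
    inv_mul_cancel := fun χ => ext' fun a => by
      rw [mul_apply, one_apply, ← (Coalgebra.Repr.arbitrary k a).eq]
      simp only [map_sum, TensorProduct.map_tmul, LinearMap.mul'_apply, AlgHom.toLinearMap_apply,
        inv_apply, ← map_mul]
      rw [← map_sum, HopfAlgebra.sum_antipode_mul_eq_algebraMap_counit, AlgHom.commutes]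
      rfl }

end CharGroup

/-! ### Twisted group algebras -/

/-- A 2-cocycle of the group `G` with values in `kˣ` (trivial action). -/
structure TwoCocycle (G : Type w) (k : Type u) [Group G] [Field k] where
  /-- The underlying function. -/
  toFun : G → G → kˣ
  cocycle : ∀ g h j, toFun g h * toFun (g * h) j = toFun h j * toFun g (h * j)

namespace TwoCocycle

variable {G : Type w} {k : Type u} [Group G] [Field k] (γ : TwoCocycle G k)

theorem one_left (g : G) : γ.toFun 1 g = γ.toFun 1 1 := by
  have := γ.cocycle 1 1 g
  simp only [one_mul] at this
  exact (mul_right_cancel this).symm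

theorem one_right (g : G) : γ.toFun g 1 = γ.toFun 1 1 := by
  have := γ.cocycle g 1 1
  simp only [mul_one] at this
  exact mul_right_cancel this

end TwoCocycle

/-- The twisted group algebra `k_γ G`: the vector space with basis `G` and with the product
`g · h = γ(g, h) gh`. -/
def TwistedGroupAlgebra {G : Type w} {k : Type u} [Group G] [Field k] (_γ : TwoCocycle G k) :
    Type _ :=
  G →₀ k

namespace TwistedGroupAlgebra

variable {G : Type w} {k : Type u} [Group G] [Field k] {γ : TwoCocycle G k}

instance : AddCommGroup (TwistedGroupAlgebra γ) := inferInstanceAs (AddCommGroup (G →₀ k))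

instance : Module k (TwistedGroupAlgebra γ) := inferInstanceAs (Module k (G →₀ k))

/-- The element `a g`, for a scalar `a` and `g ∈ G`. -/
def single (g : G) (a : k) : TwistedGroupAlgebra γ := Finsupp.single g a

/-- The product as a bilinear map. -/
def mulHom (γ : TwoCocycle G k) : (G →₀ k) →ₗ[k] (G →₀ k) →ₗ[k] (G →₀ k) :=
  Finsupp.lsum k fun g => LinearMap.toSpanSingleton k _
    (Finsupp.lsum k fun h => ((γ.toFun g h : kˣ) : k) • (Finsupp.lsingle (g * h) : k →ₗ[k] G →₀ k))

instance : Mul (TwistedGroupAlgebra γ) := ⟨fun x y => mulHom γ x y⟩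

instance : One (TwistedGroupAlgebra γ) := ⟨single 1 ((γ.toFun 1 1)⁻¹ : kˣ)⟩

theorem single_mul_single (g h : G) (a b : k) :
    (single g a * single h b : TwistedGroupAlgebra γ) =
      single (g * h) (γ.toFun g h * (a * b)) := by
  change mulHom γ (Finsupp.single g a) (Finsupp.single h b) = Finsupp.single _ _
  simp only [mulHom, Finsupp.lsum_single, LinearMap.toSpanSingleton_apply, LinearMap.smul_apply,
    Finsupp.lsingle_apply, Finsupp.smul_single, smul_eq_mul]
  congr 1
  ring

theorem induction_on' {p : TwistedGroupAlgebra γ → Prop} (x : TwistedGroupAlgebra γ)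
    (h0 : p 0) (hs : ∀ g a, p (single g a)) (ha : ∀ x y, p x → p y → p (x + y)) : p x :=
  Finsupp.induction_linear (motive := p) x h0 ha hs

theorem mul_def' (x y : TwistedGroupAlgebra γ) : x * y = mulHom γ x y := rfl

theorem add_mul' (x y z : TwistedGroupAlgebra γ) : (x + y) * z = x * z + y * z :=
  LinearMap.map_add₂ (mulHom γ) x y z

theorem mul_add' (x y z : TwistedGroupAlgebra γ) : x * (y + z) = x * y + x * z :=
  map_add (mulHom γ x) y z

theorem zero_mul' (x : TwistedGroupAlgebra γ) : 0 * x = 0 :=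
  LinearMap.map_zero₂ (mulHom γ) x

theorem mul_zero' (x : TwistedGroupAlgebra γ) : x * 0 = 0 :=
  map_zero (mulHom γ x)

instance : Ring (TwistedGroupAlgebra γ) :=
  { (inferInstance : AddCommGroup (TwistedGroupAlgebra γ)),
    (inferInstance : Mul (TwistedGroupAlgebra γ)),
    (inferInstance : One (TwistedGroupAlgebra γ)) with
    left_distrib := mul_add'
    right_distrib := add_mul'
    zero_mul := zero_mul'
    mul_zero := mul_zero'
    mul_assoc := fun x y z => by
      refine induction_on' (p := fun x => x * y * z = x * (y * z)) x
        (by simp only [zero_mul']) (fun g a => ?_)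
        (fun x x' hx hx' => by simp only [add_mul', hx, hx'])
      refine induction_on' (p := fun y => single g a * y * z = single g a * (y * z)) y
        (by simp only [zero_mul', mul_zero']) (fun h b => ?_)
        (fun y y' hy hy' => by simp only [add_mul', mul_add', hy, hy'])
      refine induction_on' (p := fun z => single g a * single h b * z =
        single g a * (single h b * z)) z (by simp only [mul_zero']) (fun j c => ?_)
        (fun z z' hz hz' => by simp only [mul_add', hz, hz'])
      have hc : ((γ.toFun g h : kˣ) : k) * γ.toFun (g * h) j = γ.toFun h j * γ.toFun g (h * j) := by
        exact_mod_cast congrArg Units.val (γ.cocycle g h j)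
      simp only [single_mul_single, mul_assoc]
      congr 1
      linear_combination (a * b * c) * hc
    one_mul := fun x => by
      refine induction_on' (p := fun x => 1 * x = x) x (mul_zero' _) (fun g a => ?_)
        (fun x x' hx hx' => by rw [mul_add', hx, hx'])
      change single 1 _ * single g a = _
      rw [single_mul_single, one_mul, TwoCocycle.one_left, ← mul_assoc, Units.mul_inv, one_mul]
    mul_one := fun x => by
      refine induction_on' (p := fun x => x * 1 = x) x (zero_mul' _) (fun g a => ?_)
        (fun x x' hx hx' => by rw [add_mul', hx, hx'])
      change single g a * single 1 _ = _
      rw [single_mul_single, mul_one, TwoCocycle.one_right, mul_left_comm, Units.mul_inv,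
        mul_one] }

instance : Algebra k (TwistedGroupAlgebra γ) :=
  Algebra.ofModule (fun r x y => LinearMap.map_smul₂ (mulHom γ) r x y)
    (fun r x y => map_smul (mulHom γ x) r y)

end TwistedGroupAlgebra

/-! ### Central Hopf subalgebras and their fibers -/

/-- The map `C → H` identifies the commutative Hopf algebra `C` with a Hopf subalgebra of the
Hopf algebra `H`. Its image is central, because `H` is a `C`-algebra. -/
class IsCentralHopfSubalgebra (k : Type u) (C : Type w) (H : Type v) [Field k] [CommRing C]
    [HopfAlgebra k C] [Ring H] [HopfAlgebra k H] [Algebra C H] [IsScalarTower k C H] : Prop where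
  injective : Function.Injective (algebraMap C H)
  counit_algebraMap : ∀ c : C,
    Coalgebra.counit (R := k) (algebraMap C H c) = Coalgebra.counit (R := k) c
  comul_algebraMap : ∀ c : C,
    Coalgebra.comul (R := k) (algebraMap C H c) =
      TensorProduct.map (IsScalarTower.toAlgHom k C H).toLinearMap
        (IsScalarTower.toAlgHom k C H).toLinearMap (Coalgebra.comul (R := k) c)
  antipode_algebraMap : ∀ c : C,
    HopfAlgebra.antipode k (algebraMap C H c) = algebraMap C H (HopfAlgebra.antipode k c)

section Fiber

variable {C : Type w} [CommRing C] (H : Type v) [Ring H] [Algebra C H]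

/-- The ideal `𝔪 H` of `H`. -/
def fiberIdeal (m : Ideal C) : Ideal H := m.map (algebraMap C H)

instance (m : Ideal C) : (fiberIdeal H m).IsTwoSided where
  mul_mem_of_left b ha := by
    unfold fiberIdeal Ideal.map at *
    induction ha using Submodule.span_induction with
    | mem x hx =>
      obtain ⟨c, hc, rfl⟩ := hx
      rw [Algebra.commutes]
      exact Ideal.mul_mem_left _ _ (Ideal.subset_span ⟨c, hc, rfl⟩)
    | zero => simp
    | add x y _ _ hx hy => rw [add_mul]; exact Ideal.add_mem _ hx hy
    | smul r x _ hx => rw [smul_eq_mul, mul_assoc]; exact Ideal.mul_mem_left _ _ hx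

/-- The fiber algebra `H / 𝔪 H`. -/
abbrev Fiber (m : Ideal C) : Type v := H ⧸ fiberIdeal H m

end Fiber

/-- The kernel of the counit of `C`. -/
def augmentationIdeal (k : Type u) (C : Type w) [Field k] [CommRing C] [HopfAlgebra k C] :
    Ideal C :=
  RingHom.ker (Bialgebra.counitAlgHom k C)

section IdentityFiber

variable (k : Type u) (C : Type w) (H : Type v) [Field k] [CommRing C] [HopfAlgebra k C]
  [Ring H] [HopfAlgebra k H] [Algebra C H] [IsScalarTower k C H]

theorem mk_algebraMap_eq (c : C) :
    Ideal.Quotient.mk (fiberIdeal H (augmentationIdeal k C)) (algebraMap C H c) =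
      algebraMap k _ (Coalgebra.counit (R := k) c) := by
  have h : c - algebraMap k C (Coalgebra.counit (R := k) c) ∈ augmentationIdeal k C := by
    simp [augmentationIdeal, RingHom.mem_ker]
  have h' := Ideal.mem_map_of_mem (algebraMap C H) h
  rw [map_sub, ← IsScalarTower.algebraMap_apply] at h'
  exact Ideal.Quotient.eq.mpr h'

variable [IsCentralHopfSubalgebra k C H]

/-- `𝔪 H` is a Hopf ideal of `H`, when `𝔪` is the kernel of the counit of `C`; by Mathlib's
quotient construction, the identity fiber is then a Hopf algebra. -/
instance : (fiberIdeal H (augmentationIdeal k C)).IsHopfIdeal k where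
  counit_eq_zero x hx := by
    have hle : fiberIdeal H (augmentationIdeal k C) ≤ RingHom.ker (Bialgebra.counitAlgHom k H) := by
      refine Ideal.map_le_iff_le_comap.mpr fun c hc => ?_
      have hc' : Coalgebra.counit (R := k) c = 0 := hc
      simp [RingHom.mem_ker, IsCentralHopfSubalgebra.counit_algebraMap, hc']
    exact hle hx
  map_mkQ_comul_eq_zero x hx := by
    let q := Ideal.Quotient.mkₐ k (fiberIdeal H (augmentationIdeal k C))
    let F := (Algebra.TensorProduct.map q q).comp (Bialgebra.comulAlgHom k H)
    have hle : fiberIdeal H (augmentationIdeal k C) ≤ RingHom.ker F := by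
      refine Ideal.map_le_iff_le_comap.mpr fun c hc => ?_
      have hc' : Coalgebra.counit (R := k) c = 0 := hc
      have hq : q.toLinearMap ∘ₗ (IsScalarTower.toAlgHom k C H).toLinearMap =
          Algebra.linearMap k _ ∘ₗ Coalgebra.counit := by
        ext c
        exact mk_algebraMap_eq k C H c
      rw [Ideal.mem_comap, RingHom.mem_ker]
      change TensorProduct.map q.toLinearMap q.toLinearMap
        (Coalgebra.comul (R := k) (algebraMap C H c)) = 0
      rw [IsCentralHopfSubalgebra.comul_algebraMap, ← LinearMap.comp_apply,
        ← TensorProduct.map_comp, hq, ← (Coalgebra.Repr.arbitrary k c).eq, map_sum]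
      set 𝓡 := Coalgebra.Repr.arbitrary k c
      have hs : ∑ i ∈ 𝓡.index, Coalgebra.counit (R := k) (𝓡.left i) *
          Coalgebra.counit (R := k) (𝓡.right i) = 0 := by
        have := congrArg (Coalgebra.counit (R := k)) (Coalgebra.sum_counit_smul 𝓡)
        simpa [hc'] using this
      simp only [TensorProduct.map_tmul, LinearMap.comp_apply, Algebra.linearMap_apply,
        Algebra.algebraMap_eq_smul_one, TensorProduct.smul_tmul_smul, ← Finset.sum_smul]
      rw [hs, zero_smul]
    exact hle hx
  antipode_mem x hx := by
    unfold fiberIdeal Ideal.map at hx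
    induction hx using Submodule.span_induction with
    | mem x hx =>
      obtain ⟨c, hc, rfl⟩ := hx
      rw [IsCentralHopfSubalgebra.antipode_algebraMap]
      refine Ideal.mem_map_of_mem (algebraMap C H) ?_
      have hc' : Coalgebra.counit (R := k) c = 0 := hc
      simp [augmentationIdeal, RingHom.mem_ker, hc']
    | zero => simp
    | add x y _ _ hx hy => rw [map_add]; exact Ideal.add_mem _ hx hy
    | smul r x _ hx =>
      rw [smul_eq_mul, HopfAlgebra.antipode_mul_antidistrib]
      exact Ideal.mul_mem_right _ _ hx

/-- The identity fiber, a Hopf algebra. -/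
abbrev IdentityFiber : Type v := Fiber H (augmentationIdeal k C)

/-- The group `G₀` of characters of the identity fiber. -/
abbrev G₀ : Type _ := CharGroup k (IdentityFiber k C H)

end IdentityFiber

namespace AlgModule

variable {k : Type u} {C : Type w} {H : Type v} [Field k] [CommRing C] [HopfAlgebra k C]
  [Ring H] [HopfAlgebra k H] [Algebra C H] [IsScalarTower k C H]

/-- A module of a fiber algebra, viewed as a module of `H`. -/
def inflate {m : Ideal C} (M : AlgModule.{u, v, w₁} k (Fiber H m)) : AlgModule.{u, v, w₁} k H :=
  M.restrict (Ideal.Quotient.mkₐ k (fiberIdeal H m))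

end AlgModule

section Stabilizer

variable {k : Type u} {C : Type w} {H : Type v} [Field k] [CommRing C] [HopfAlgebra k C]
  [Ring H] [HopfAlgebra k H] [Algebra C H] [IsScalarTower k C H] [IsCentralHopfSubalgebra k C H]

/-- The one-dimensional module of `H` given by an element of `G₀`. -/
def G₀.toModule (χ : G₀ k C H) : AlgModule.{u, v, u} k H :=
  (AlgModule.ofCharacter χ.toAlgHom).inflate

/-- `L` is a choice, for all `χ` in the group `S` of characters of the identity fiber, of
isomorphisms of `H`-modules `L χ : V → χ⁻¹ ⊗ V`, where the vector space `k ⊗ V` is identified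
with `V`. -/
def IsTwistedIsoFamily (S : Subgroup (G₀ k C H)) (V : AlgModule.{u, v, w₁} k H)
    (L : S → (V ≃ₗ[k] V)) : Prop :=
  ∀ χ : S, AlgModule.IsHom (M := V) (N := (G₀.toModule (χ : G₀ k C H)⁻¹).tensor V)
    ((L χ).trans (TensorProduct.lid k V).symm).toLinearMap

end Stabilizer

end

/-!
# Irreducible modules over the fibers of a Hopf algebra that is finite over a central subalgebra

**Fibers.** By the Artin–Tate lemma `C` is finitely generated, so every maximal ideal `𝔪` is the
kernel of a character `φ` of `C`; the fibers are finite dimensional, and nonzero by Nakayama's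
lemma. A module of `H` comes from the fiber at `𝔪` exactly when `C` acts on it by `φ`.

**Quotients and submodules of tensor products.** If `C` acts by the same character on `V` and `W`,
then it acts by the counit on `Hom(V, W) ≅ W ⊗ V*`, with `h` acting by `T ↦ ∑ h₁ T S(h₂)`. An
irreducible `M' ⊆ Hom(V, W)` is therefore a module of the identity fiber, and the evaluation
`M' ⊗ V → W` is nonzero, hence surjective. Starting instead from a surjection `f : M' ⊗ W → V`, the
map `w ↦ f (- ⊗ w)` embeds `W` in `Hom(M', V) ≅ M'' ⊗ V`, where `M''` is the dual of `M'` on which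
`h` acts through the inverse of the antipode of the identity fiber.

**Bijectivity of the antipode.** That inverse exists because the antipode of every finite
dimensional Hopf algebra is bijective (`HopfAlgebra.antipode_bijective`). A homomorphism of
coalgebras `f` into a Hopf algebra has the convolution inverse `S ∘ f`, so that `S ∘ f`, and
likewise `S² ∘ f`, determines `f`. In finite dimension, `S²` has a power `τ` and there is an
idempotent homomorphism of coalgebras `π` with the same kernel as `τ` and `τ ∘ π = τ`; cancelling
`S²` gives `π = 1`, so `S²` is injective.

**Weights.** A character `χ ∈ G₀` gives the endomorphism `h ↦ ∑ χ(h₁) h₂` of `H`, which fixes `C`;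
restriction along it is `V ↦ χ ⊗ V`. An isomorphism `χ ⊗ V ≅ V` is the same as an invertible
`T ∈ End(V)` with `∑ h₁ T S(h₂) = χ(h) T`, as a computation in the convolution algebra
`Hom(H, End(V))` shows. Such weight vectors for distinct `χ` are linearly independent by Dedekind's
theorem, whence the bound `dim(V)²` on the stabilizer. In the case of equality they form a basis of
`End(V) ≅ V ⊗ V*`, which gives the decomposition into characters and, since products of weight
vectors are weight vectors and weight spaces are lines by Schur's lemma, the isomorphism with the
twisted group algebra. The algebra `H / Ann(V)` is `End(V)` by Burnside's theorem.

**Basic identity fibers.** All `M'` are then characters `χ`, and the surjection `χ ⊗ V → W` is an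
isomorphism because `χ ⊗ V` is irreducible.
-/

universe w₃

noncomputable section

/-! ### Bijectivity of the antipode of a finite dimensional Hopf algebra -/

namespace HopfAlgebra

open Coalgebra WithConv LinearMap

variable {k : Type u} {A : Type v} [Field k] [Ring A] [HopfAlgebra k A]

/-- In the convolution algebra of maps `A → A ⊗ A`, the comultiplication is the product of the two
inclusions of `A`, so that the right hand side is its inverse, as is `Δ ∘ S`. -/
theorem comul_comp_antipode :
    (comul ∘ₗ antipode k : A →ₗ[k] A ⊗[k] A) =
      TensorProduct.map (antipode k) (antipode k) ∘ₗ
        (TensorProduct.comm k A A).toLinearMap ∘ₗ comul := by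
  apply toConv_injective
  refine (left_inv_eq_right_inv (a := toConv (comul (R := k) (A := A))) ?_
    LinearMap.comul_right_inv).symm
  let i₁ : A →ₐ[k] A ⊗[k] A := Algebra.TensorProduct.includeLeft
  let i₂ : A →ₐ[k] A ⊗[k] A := Algebra.TensorProduct.includeRight
  have hδ : toConv (comul (R := k) (A := A)) =
      toConv i₁.toLinearMap * toConv i₂.toLinearMap := by
    ext a
    rw [(ℛ k a).convMul_apply]
    simpa [i₁, i₂] using (ℛ k a).eq.symm
  have hG : toConv (TensorProduct.map (antipode k) (antipode k) ∘ₗ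
        (TensorProduct.comm k A A).toLinearMap ∘ₗ comul) =
      toConv (i₂.toLinearMap ∘ₗ antipode k) * toConv (i₁.toLinearMap ∘ₗ antipode k) := by
    ext a
    rw [(ℛ k a).convMul_apply]
    change TensorProduct.map _ _ (TensorProduct.comm k A A (comul a)) = _
    rw [← (ℛ k a).eq]
    simp [i₁, i₂]
  have hi (i : A →ₐ[k] A ⊗[k] A) :
      toConv (i.toLinearMap ∘ₗ antipode k) * toConv i.toLinearMap = 1 := by
    have := algHom_comp_convMul_distrib (R := k) i (toConv (antipode k)) (toConv LinearMap.id)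
    rw [antipode_mul_id] at this
    apply ofConv_injective
    simp only [LinearMap.comp_id] at this
    rw [← this]
    ext a
    simp
  rw [hδ, hG, mul_assoc, ← mul_assoc (toConv (i₁.toLinearMap ∘ₗ _)), hi i₁, one_mul, hi i₂]

/-- The square of the antipode is a homomorphism of coalgebras. -/
def antipodeSq : A →ₗc[k] A where
  __ := antipode k ∘ₗ antipode k
  counit_comp := by ext; simp
  map_comp_comul := by
    have h (a : A) : comul (R := k) (antipode k a) = TensorProduct.map (antipode k) (antipode k)
        (TensorProduct.comm k A A (comul a)) := LinearMap.congr_fun comul_comp_antipode a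
    ext a
    change TensorProduct.map (antipode k ∘ₗ antipode k) (antipode k ∘ₗ antipode k) (comul a) =
      comul (antipode k (antipode k a))
    rw [h, h]
    induction comul (R := k) a with
    | zero => simp
    | tmul x y => simp
    | add x y hx hy => simp only [map_add, hx, hy]

/-- For a homomorphism of coalgebras `f`, the convolution inverse of `f` is `S ∘ f` and the inverse
of `S ∘ f`, for the opposite multiplication, is `S ∘ S ∘ f`. Hence `S ∘ S ∘ f` determines `f`. -/
theorem antipodeSq_comp_injective {D : Type*} [AddCommGroup D] [Module k D] [Coalgebra k D]
    {f g : D →ₗc[k] A}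
    (h : antipodeSq.toLinearMap ∘ₗ f.toLinearMap = antipodeSq.toLinearMap ∘ₗ g.toLinearMap) :
    f.toLinearMap = g.toLinearMap := by
  -- precomposition with a coalgebra homomorphism is multiplicative for the convolution
  have key {B : Type v} [Ring B] [Algebra k B] (x y : WithConv (A →ₗ[k] B)) (hxy : x * y = 1)
      (f : D →ₗc[k] A) :
      toConv (x.ofConv ∘ₗ f.toLinearMap) * toConv (y.ofConv ∘ₗ f.toLinearMap) = 1 := by
    have := convMul_comp_coalgHom_distrib x y f
    rw [hxy] at this
    apply ofConv_injective
    rw [← this]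
    ext a
    simp
  let s : A →ₐ[k] Aᵐᵒᵖ := antipodeAlgHomOp k A
  have hs (x y : WithConv (A →ₗ[k] A)) (hxy : x * y = 1) :
      toConv (s.toLinearMap ∘ₗ x.ofConv) * toConv (s.toLinearMap ∘ₗ y.ofConv) = 1 := by
    have := algHom_comp_convMul_distrib (R := k) s x y
    rw [hxy] at this
    apply ofConv_injective
    rw [← this]
    ext a
    simp
  have h1 (f : D →ₗc[k] A) := key _ _ (hs _ _ (antipode_mul_id (R := k) (C := A))) f
  have h2 (f : D →ₗc[k] A) := key _ _ (hs _ _ (id_mul_antipode (R := k) (C := A))) f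
  have h3 (f : D →ₗc[k] A) := key _ _ (antipode_mul_id (R := k) (C := A)) f
  have h4 (f : D →ₗc[k] A) := key _ _ (id_mul_antipode (R := k) (C := A)) f
  have hSS : (s.toLinearMap ∘ₗ antipode k) ∘ₗ f.toLinearMap =
      (s.toLinearMap ∘ₗ antipode k) ∘ₗ g.toLinearMap := by
    ext d
    exact congrArg MulOpposite.op (LinearMap.congr_fun h d)
  have hS : antipode k ∘ₗ f.toLinearMap = antipode k ∘ₗ g.toLinearMap := by
    have h1f := h1 f
    have h2g := h2 g
    simp only at h1f h2g
    rw [hSS] at h1f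
    have := toConv_injective (left_inv_eq_right_inv h2g h1f)
    ext d
    exact (MulOpposite.op_injective (LinearMap.congr_fun this d)).symm
  have h3f := h3 f
  have h4g := h4 g
  simp only at h3f h4g
  rw [hS] at h3f
  exact (toConv_injective (left_inv_eq_right_inv h4g h3f)).symm

/-- An element of a finite dimensional algebra is strongly `π`-regular: its minimal polynomial is
`X ^ n * q` with `q(0) ≠ 0`, which gives `y` as a polynomial in `s`. -/
theorem _root_.exists_pow_succ_mul_eq_pow {E : Type*} [Ring E] [Algebra k E] [Module.Finite k E]
    (s : E) : ∃ (n : ℕ) (y : E), Commute s y ∧ s ^ (n + 1) * y = s ^ n := by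
  have hne : minpoly k s ≠ 0 := minpoly.ne_zero (Algebra.IsIntegral.isIntegral s)
  obtain ⟨q, hq, hd⟩ := Polynomial.exists_eq_pow_rootMultiplicity_mul_and_not_dvd _ hne 0
  set n := (minpoly k s).rootMultiplicity 0
  rw [Polynomial.C_0, sub_zero] at hq hd
  rw [Polynomial.X_dvd_iff] at hd
  have h0 : Polynomial.aeval s (Polynomial.X ^ n * q) = 0 := by rw [← hq, minpoly.aeval]
  have hcomm (p : Polynomial k) : Commute s (Polynomial.aeval s p) := by
    have := (Commute.all Polynomial.X p).map (Polynomial.aeval (R := k) s)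
    rwa [Polynomial.aeval_X] at this
  refine ⟨n, Polynomial.aeval s (Polynomial.C (-(q.coeff 0)⁻¹) * q.divX), hcomm _, ?_⟩
  have : Polynomial.X ^ (n + 1) * (Polynomial.C (-(q.coeff 0)⁻¹) * q.divX) =
      Polynomial.X ^ n - Polynomial.C (q.coeff 0)⁻¹ * (Polynomial.X ^ n * q) := by
    conv_rhs => rw [← Polynomial.divX_mul_X_add q]
    have hC : Polynomial.C (q.coeff 0)⁻¹ * Polynomial.C (q.coeff 0) = 1 := by
      rw [← Polynomial.C_mul, inv_mul_cancel₀ hd, Polynomial.C_1]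
    simp only [Polynomial.C_neg, Polynomial.coeff_add, Polynomial.coeff_mul_X_zero,
      Polynomial.coeff_C_zero, zero_add]
    linear_combination Polynomial.X ^ n * hC
  have := congrArg (Polynomial.aeval s) this
  simpa only [map_mul, map_sub, h0, mul_zero, sub_zero, map_pow, Polynomial.aeval_X] using this

/-- The antipode of a finite dimensional Hopf algebra is bijective. With `τ` a high power of
`σ = S²` and `θ` its inverse on the image of `τ`, the idempotent `π = τ θ` is a homomorphism of
coalgebras and `τ π = τ`; as `σ` can be cancelled from such an equation, `π = 1`. -/
theorem antipode_bijective [Module.Finite k A] : Function.Bijective (antipode k (A := A)) := by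
  let s : Module.End k A := (antipodeSq (k := k) (A := A)).toLinearMap
  obtain ⟨n, y, hc, hy⟩ := exists_pow_succ_mul_eq_pow (k := k) s
  -- the powers of `s` as homomorphisms of coalgebras
  have hpow (n : ℕ) : ∃ t : A →ₗc[k] A, t.toLinearMap = s ^ n := by
    induction n with
    | zero => exact ⟨CoalgHom.id k A, rfl⟩
    | succ n ih =>
      obtain ⟨t, ht⟩ := ih
      refine ⟨antipodeSq.comp t, ?_⟩
      rw [pow_succ', ← ht]
      rfl
  have hyn (j : ℕ) : s ^ (n + j) * y ^ j = s ^ n := by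
    induction j with
    | zero => simp
    | succ j ih =>
      rw [pow_succ' y, ← mul_assoc, show n + (j + 1) = j + (n + 1) by ring, pow_add, mul_assoc _ _ y,
        hy, ← pow_add, add_comm j n, ih]
  obtain ⟨t, ht⟩ := hpow n
  let τ : Module.End k A := s ^ n
  let θ : Module.End k A := y ^ n
  have hcc : Commute τ θ := (hc.pow_pow n n)
  have hτ : τ * τ * θ = τ := by
    rw [← pow_add]
    exact hyn n
  have hτ' : τ ∘ₗ τ ∘ₗ θ = τ := hτ
  have hcτ : θ ∘ₗ τ = τ ∘ₗ θ := hcc.eq.symm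
  have hθ : θ ∘ₗ τ ∘ₗ τ = τ := by
    change θ * (τ * τ) = τ
    rw [← (hcc.mul_left hcc).eq, hτ]
  have hε : counit (R := k) (A := A) ∘ₗ τ = counit := by
    rw [show τ = t.toLinearMap from ht.symm]
    exact t.counit_comp
  have hΔ : TensorProduct.map τ τ ∘ₗ comul (R := k) (A := A) = comul ∘ₗ τ := by
    rw [show τ = t.toLinearMap from ht.symm]
    exact t.map_comp_comul
  have hεθ : counit (R := k) (A := A) ∘ₗ θ = counit := by
    conv_lhs => rw [← hε, ← hε, LinearMap.comp_assoc, LinearMap.comp_assoc, hτ', hε]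
  have hΔ2 : TensorProduct.map (τ ∘ₗ τ) (τ ∘ₗ τ) ∘ₗ comul (R := k) (A := A) =
      comul ∘ₗ τ ∘ₗ τ := by
    rw [TensorProduct.map_comp, LinearMap.comp_assoc, hΔ, ← LinearMap.comp_assoc, hΔ,
      LinearMap.comp_assoc]
  have hπΔ : TensorProduct.map (τ ∘ₗ θ) (τ ∘ₗ θ) ∘ₗ comul (R := k) (A := A) =
      comul ∘ₗ τ ∘ₗ θ := by
    calc TensorProduct.map (τ ∘ₗ θ) (τ ∘ₗ θ) ∘ₗ comul (R := k) (A := A)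
        = TensorProduct.map θ θ ∘ₗ comul ∘ₗ τ := by
          rw [← hcτ, TensorProduct.map_comp, LinearMap.comp_assoc, hΔ]
      _ = TensorProduct.map θ θ ∘ₗ (comul ∘ₗ τ ∘ₗ τ) ∘ₗ θ := by
          rw [LinearMap.comp_assoc, LinearMap.comp_assoc, hτ']
      _ = TensorProduct.map (θ ∘ₗ τ ∘ₗ τ) (θ ∘ₗ τ ∘ₗ τ) ∘ₗ comul ∘ₗ θ := by
          rw [← hΔ2, TensorProduct.map_comp θ, LinearMap.comp_assoc, LinearMap.comp_assoc]
      _ = comul ∘ₗ τ ∘ₗ θ := by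
          rw [hθ, ← LinearMap.comp_assoc, hΔ, LinearMap.comp_assoc]
  let π : A →ₗc[k] A :=
    { (τ ∘ₗ θ) with
      counit_comp := by
        change counit (R := k) (A := A) ∘ₗ τ ∘ₗ θ = counit
        rw [← LinearMap.comp_assoc, hε, hεθ]
      map_comp_comul := hπΔ }
  have hcancel (j : ℕ) : ∀ f g : A →ₗc[k] A, s ^ j * f.toLinearMap = s ^ j * g.toLinearMap →
      f.toLinearMap = g.toLinearMap := by
    induction j with
    | zero => intro f g h; simpa using h
    | succ j ih =>
      intro f g h
      obtain ⟨t, ht⟩ := hpow j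
      refine ih f g ?_
      rw [← ht]
      refine antipodeSq_comp_injective (f := t.comp f) (g := t.comp g) ?_
      rw [pow_succ', mul_assoc, mul_assoc, ← ht] at h
      exact h
  have hπ : τ * θ = 1 := hcancel n π (CoalgHom.id k A) (by
    change τ * (τ * θ) = τ * 1
    rw [← mul_assoc, hτ, mul_one])
  have hsy : s * y = 1 := by
    calc s * y = s * (τ * θ) * y := by rw [hπ, mul_one]
      _ = s ^ (n + 1) * y * θ := by
          have h : θ * y = y * θ := ((Commute.refl y).pow_left n).eq
          simp only [pow_succ', mul_assoc, h]
          rfl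
      _ = 1 := by rw [hy]; exact hπ
  have hys : y * s = 1 := by rw [← hc.eq, hsy]
  constructor
  · intro a b hab
    have h := congrArg (fun z => y (antipode k z)) hab
    have hy' (a : A) : y (antipode k (antipode k a)) = a := LinearMap.congr_fun hys a
    simpa only [hy'] using h
  · exact fun a => ⟨antipode k (y a), LinearMap.congr_fun hsy a⟩

end HopfAlgebra

/-! ### Irreducible modules -/

namespace AlgModule

section Irreducible

variable {k : Type u} {A : Type v} [Field k] [Ring A] [Algebra k A]

/-- A subspace of a module that is stable under the action. -/
def IsStable (M : AlgModule.{u, v, w} k A) (N : Submodule k M) : Prop :=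
  ∀ (a : A), ∀ x ∈ N, M.act a x ∈ N

/-- A stable subspace, as a module. -/
def sub (M : AlgModule.{u, v, w} k A) (N : Submodule k M) (hN : M.IsStable N) :
    AlgModule.{u, v, w} k A where
  carrier := N
  act :=
    { toFun := fun a => (M.act a).restrict (hN a)
      map_one' := by ext; simp
      map_mul' := fun a b => by ext; simp
      map_zero' := by ext; simp
      map_add' := fun a b => by ext; simp
      commutes' := fun r => by ext; simp }

theorem isIrreducible_iff (M : AlgModule.{u, v, w} k A) :
    M.IsIrreducible ↔
      Nontrivial M ∧ ∀ N : Submodule k M, M.IsStable N → N = ⊥ ∨ N = ⊤ := by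
  let : Module A M := Module.compHom M M.act.toRingHom
  have hsmul (a : A) (x : M) : a • x = M.act a x := rfl
  change IsSimpleModule A M ↔ _
  constructor
  · intro h
    refine ⟨IsSimpleModule.nontrivial A M, fun N hN => ?_⟩
    let N' : Submodule A M := { N.toAddSubmonoid with smul_mem' := fun a x hx => hN a x hx }
    rcases eq_bot_or_eq_top N' with h' | h'
    · left
      rw [eq_bot_iff]
      intro x hx
      have : x ∈ N' := hx
      rwa [h'] at this
    · right
      rw [eq_top_iff]
      intro x _
      have : x ∈ N' := h' ▸ Submodule.mem_top
      exact this
  · rintro ⟨hn, h⟩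
    refine { exists_pair_ne := ⟨⊥, ⊤, bot_ne_top⟩, eq_bot_or_eq_top := fun N => ?_ }
    let N' : Submodule k M :=
      { N.toAddSubmonoid with
        smul_mem' := fun r x hx => by
          have := N.smul_mem (algebraMap k A r) hx
          rwa [hsmul, AlgHom.commutes, Module.algebraMap_end_apply] at this }
    rcases h N' (fun a x hx => N.smul_mem a hx) with h' | h'
    · left
      rw [eq_bot_iff]
      intro x hx
      have : x ∈ N' := hx
      rwa [h'] at this
    · right
      rw [eq_top_iff]
      intro x _
      have : x ∈ N' := h' ▸ Submodule.mem_top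
      exact this

theorem IsIrreducible.nontrivial {M : AlgModule.{u, v, w} k A} (h : M.IsIrreducible) :
    Nontrivial M := ((isIrreducible_iff M).1 h).1

theorem IsIrreducible.eq_bot_or_eq_top {M : AlgModule.{u, v, w} k A} (h : M.IsIrreducible)
    {N : Submodule k M} (hN : M.IsStable N) : N = ⊥ ∨ N = ⊤ :=
  ((isIrreducible_iff M).1 h).2 N hN

theorem IsHom.isStable_range {M : AlgModule.{u, v, w₁} k A} {N : AlgModule.{u, v, w₂} k A}
    {f : M →ₗ[k] N} (hf : IsHom f) : N.IsStable (LinearMap.range f) := by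
  rintro a _ ⟨x, rfl⟩
  exact ⟨M.act a x, hf a x⟩

theorem IsHom.isStable_ker {M : AlgModule.{u, v, w₁} k A} {N : AlgModule.{u, v, w₂} k A}
    {f : M →ₗ[k] N} (hf : IsHom f) : M.IsStable (LinearMap.ker f) := by
  intro a x hx
  rw [LinearMap.mem_ker] at hx ⊢
  rw [hf, hx, map_zero]

theorem IsHom.surjective {M : AlgModule.{u, v, w₁} k A} {N : AlgModule.{u, v, w₂} k A}
    {f : M →ₗ[k] N} (hf : IsHom f) (hN : N.IsIrreducible) (h0 : f ≠ 0) :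
    Function.Surjective f := by
  rcases hN.eq_bot_or_eq_top hf.isStable_range with h | h
  · exact absurd (LinearMap.range_eq_bot.1 h) h0
  · exact LinearMap.range_eq_top.1 h

theorem IsHom.injective {M : AlgModule.{u, v, w₁} k A} {N : AlgModule.{u, v, w₂} k A}
    {f : M →ₗ[k] N} (hf : IsHom f) (hM : M.IsIrreducible) (h0 : f ≠ 0) :
    Function.Injective f := by
  rcases hM.eq_bot_or_eq_top hf.isStable_ker with h | h
  · exact LinearMap.ker_eq_bot.1 h
  · exact absurd (LinearMap.ker_eq_top.1 h) h0

theorem IsHom.iso {M : AlgModule.{u, v, w₁} k A} {N : AlgModule.{u, v, w₂} k A}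
    {f : M →ₗ[k] N} (hf : IsHom f) (h : Function.Bijective f) : M.Iso N :=
  ⟨LinearEquiv.ofBijective f h, fun a x => hf a x⟩

theorem IsHom.isIrreducible {M : AlgModule.{u, v, w₁} k A} {N : AlgModule.{u, v, w₂} k A}
    {f : M →ₗ[k] N} (hf : IsHom f) (h : Function.Bijective f) (hM : M.IsIrreducible) :
    N.IsIrreducible := by
  rw [isIrreducible_iff]
  have := hM.nontrivial
  refine ⟨h.1.nontrivial, fun P hP => ?_⟩
  have hs : M.IsStable (P.comap f) := fun a x hx => by
    rw [Submodule.mem_comap] at hx ⊢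
    rw [hf]
    exact hP a _ hx
  rcases hM.eq_bot_or_eq_top hs with h' | h'
  · left
    rw [← Submodule.map_comap_eq_of_surjective h.2 P, h', Submodule.map_bot]
  · right
    rw [← Submodule.map_comap_eq_of_surjective h.2 P, h', Submodule.map_top,
      LinearMap.range_eq_top.2 h.2]

theorem Iso.isIrreducible {M : AlgModule.{u, v, w₁} k A} {N : AlgModule.{u, v, w₂} k A}
    (h : M.Iso N) (hM : M.IsIrreducible) : N.IsIrreducible := by
  obtain ⟨e, he⟩ := h
  exact he.isIrreducible e.bijective hM

/-- A nonzero finite dimensional module contains an irreducible module: a stable subspace that is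
minimal among the nonzero ones. -/
theorem exists_irreducible_sub (M : AlgModule.{u, v, w} k A) [Module.Finite k M] [Nontrivial M] :
    ∃ (N : Submodule k M) (hN : M.IsStable N), (M.sub N hN).IsIrreducible := by
  let S : Set (Submodule k M) := {N | M.IsStable N ∧ N ≠ ⊥}
  have hS : S.Nonempty := ⟨⊤, fun _ _ _ => Submodule.mem_top, top_ne_bot⟩
  obtain ⟨N, ⟨hN, hN0⟩, hmin⟩ := WellFounded.has_min (wellFounded_lt (α := Submodule k M)) S hS
  refine ⟨N, hN, (isIrreducible_iff _).2 ⟨Submodule.nontrivial_iff_ne_bot.2 hN0, fun P hP => ?_⟩⟩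
  change Submodule k N at P
  by_cases h0 : P = ⊥
  · exact Or.inl h0
  right
  have hP' : P.map N.subtype ∈ S := by
    constructor
    · rintro a _ ⟨x, hx, rfl⟩
      exact ⟨_, hP a x hx, rfl⟩
    · intro hbot
      refine h0 (Submodule.map_injective_of_injective N.injective_subtype ?_)
      rw [hbot, Submodule.map_bot]
  have hnot := hmin _ hP'
  have hle : P.map N.subtype ≤ N := Submodule.map_subtype_le N P
  have heq : P.map N.subtype = N := by
    by_contra hne
    exact hnot (lt_of_le_of_ne hle hne)
  refine (Submodule.eq_top_iff' (p := P)).2 fun x => ?_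
  have hx : (x : M) ∈ P.map N.subtype := heq.symm ▸ x.2
  obtain ⟨y, hy, hyx⟩ := hx
  rwa [← Subtype.ext hyx]

/-- An irreducible module is cyclic, hence finite dimensional over a finite dimensional algebra. -/
theorem IsIrreducible.finite [Module.Finite k A] {M : AlgModule.{u, v, w} k A}
    (h : M.IsIrreducible) : Module.Finite k M := by
  have := h.nontrivial
  obtain ⟨x, hx⟩ := exists_ne (0 : M)
  let f : A →ₗ[k] M := (LinearMap.applyₗ x) ∘ₗ M.act.toLinearMap
  have hf (a : A) : f a = M.act a x := rfl
  have hst : M.IsStable (LinearMap.range f) := by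
    rintro a _ ⟨b, rfl⟩
    exact ⟨a * b, by simp [hf]⟩
  rcases h.eq_bot_or_eq_top hst with h' | h'
  · have h1 : f 1 = 0 := by rw [LinearMap.range_eq_bot.1 h', LinearMap.zero_apply]
    rw [hf, map_one] at h1
    exact absurd h1 hx
  · exact Module.Finite.of_surjective f (LinearMap.range_eq_top.1 h')

/-- Schur's lemma. -/
theorem IsIrreducible.exists_smul_eq [IsAlgClosed k] {M : AlgModule.{u, v, w} k A}
    [Module.Finite k M] (h : M.IsIrreducible) {f : M →ₗ[k] M} (hf : IsHom f) :
    ∃ r : k, ∀ x, f x = r • x := by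
  have := h.nontrivial
  obtain ⟨r, hr⟩ := Module.End.exists_eigenvalue f
  refine ⟨r, fun x => ?_⟩
  have hst : M.IsStable (Module.End.eigenspace f r) := fun a x hx => by
    rw [Module.End.mem_eigenspace_iff] at hx ⊢
    rw [hf, hx, map_smul]
  rcases h.eq_bot_or_eq_top hst with h' | h'
  · exact absurd h' hr
  · exact Module.End.mem_eigenspace_iff.1 (h' ▸ Submodule.mem_top)

/-- Burnside's theorem, a consequence of Schur's lemma and of the density theorem. -/
theorem IsIrreducible.act_surjective [IsAlgClosed k] {M : AlgModule.{u, v, w} k A}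
    [Module.Finite k M] (h : M.IsIrreducible) : Function.Surjective M.act := by
  let : Module A M := Module.compHom M M.act.toRingHom
  have hsmul (a : A) (x : M) : a • x = M.act a x := rfl
  have : IsSimpleModule A M := h
  intro f
  have hscal (g : Module.End A M) : ∃ r : k, ∀ x, g x = r • x := by
    let g' : M →ₗ[k] M :=
      { toFun := g
        map_add' := g.map_add
        map_smul' := fun r x => by
          have := g.map_smul (algebraMap k A r) x
          rwa [hsmul, hsmul, AlgHom.commutes, Module.algebraMap_end_apply,
            Module.algebraMap_end_apply] at this }
    exact h.exists_smul_eq (f := g') fun a x => g.map_smul a x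
  let f' : Module.End (Module.End A M) M :=
    { toFun := f
      map_add' := f.map_add
      map_smul' := fun g x => by
        obtain ⟨r, hr⟩ := hscal g
        simp only [Module.End.smul_def, hr, map_smul, RingHom.id_apply] }
  obtain ⟨s, hs⟩ := Module.Finite.fg_top (R := k) (M := M)
  obtain ⟨a, ha⟩ := jacobson_density (R := A) f' s
  refine ⟨a, ?_⟩
  refine LinearMap.ext_on hs fun x hx => ?_
  exact (ha x hx).symm

end Irreducible

end AlgModule

/-! ### Central subalgebras and the action of the central characters -/

/-- The Artin–Tate lemma for a not necessarily commutative algebra `H` that is finite over a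
central subalgebra `C`: `H` is finite over the subalgebra of `C` that is generated by finitely many
structure constants. -/
theorem finiteType_of_finite_of_injective (k : Type u) (C : Type w) (H : Type v) [Field k]
    [CommRing C] [Algebra k C] [Ring H] [Algebra k H] [Algebra C H] [IsScalarTower k C H]
    [Algebra.FiniteType k H] [Module.Finite C H]
    (hinj : Function.Injective (algebraMap C H)) : Algebra.FiniteType k C := by
  classical
  obtain ⟨X, hX⟩ := Algebra.FiniteType.out (R := k) (A := H)
  obtain ⟨Y, hY⟩ := Module.Finite.fg_top (R := C) (M := H)
  have hc (h : H) : ∃ c : H → C, ∑ y ∈ Y, c y • y = h := by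
    have : h ∈ Submodule.span C (Y : Set H) := hY ▸ Submodule.mem_top
    obtain ⟨c, -, hc⟩ := Submodule.mem_span_finset.1 this
    exact ⟨c, hc⟩
  choose c hc using hc
  let Z : Finset H := X ∪ Finset.image₂ (· * ·) Y Y ∪ {1}
  let s : Finset C := Finset.image₂ c Z Y
  let A : Subalgebra k C := Algebra.adjoin k s
  have hA : Algebra.FiniteType k A := (Subalgebra.fg_iff_finiteType A).1 ⟨s, rfl⟩
  have hN : IsNoetherianRing A := Algebra.FiniteType.isNoetherianRing k A
  let P : Submodule A H := Submodule.span A (Y : Set H)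
  have hZ : ∀ z ∈ Z, z ∈ P := by
    intro z hz
    rw [← hc z]
    refine Submodule.sum_mem _ fun y hy => ?_
    have h : c z y ∈ A := Algebra.subset_adjoin (Finset.mem_image₂_of_mem hz hy)
    exact P.smul_mem (⟨c z y, h⟩ : A) (Submodule.subset_span hy)
  have hmul : P * P ≤ P := by
    rw [Submodule.span_mul_span, Submodule.span_le]
    rintro _ ⟨a, ha, b, hb, rfl⟩
    exact hZ _ (by
      simp only [Z, Finset.mem_union]
      exact Or.inl (Or.inr (Finset.mem_image₂_of_mem ha hb)))
  have h1 : (1 : H) ∈ P := hZ 1 (by simp [Z])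
  let B : Subalgebra k H :=
    { carrier := P
      mul_mem' := fun ha hb => hmul (Submodule.mul_mem_mul ha hb)
      add_mem' := fun ha hb => P.add_mem ha hb
      algebraMap_mem' := fun r => by
        have := P.smul_mem (algebraMap k A r) h1
        rwa [Algebra.smul_def, mul_one, ← IsScalarTower.algebraMap_apply] at this }
  have hB : B = ⊤ := by
    rw [eq_top_iff, ← hX, Algebra.adjoin_le_iff]
    intro x hx
    exact hZ x (by simp only [Z, Finset.mem_union]; exact Or.inl (Or.inl hx))
  have hP : P = ⊤ := by
    rw [eq_top_iff]
    intro x _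
    exact (hB ▸ Algebra.mem_top : x ∈ B)
  have hfin : Module.Finite A H := ⟨⟨Y, hP⟩⟩
  have hfinC : Module.Finite A C :=
    Module.Finite.of_injective ((Algebra.linearMap C H).restrictScalars A) hinj
  exact Algebra.FiniteType.trans hA inferInstance

section Character

variable (k : Type u) {C : Type w} (H : Type v) [Field k] [CommRing C] [Algebra k C]
  [Ring H] [Algebra k H] [Algebra C H] [IsScalarTower k C H]

/-- The weak Nullstellensatz: the residue field of a maximal ideal is the base field. -/
theorem exists_character [IsAlgClosed k] [Algebra.FiniteType k C] (m : Ideal C) [hm : m.IsMaximal] :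
    ∃ φ : C →ₐ[k] k, RingHom.ker φ = m := by
  let : Field (C ⧸ m) := Ideal.Quotient.field m
  have : Algebra.FiniteType k (C ⧸ m) :=
    Algebra.FiniteType.of_surjective (Ideal.Quotient.mkₐ k m) (Ideal.Quotient.mkₐ_surjective k m)
  have : Module.Finite k (C ⧸ m) := finite_of_finite_type_of_isJacobsonRing k (C ⧸ m)
  have hb := IsAlgClosed.algebraMap_bijective_of_isIntegral (k := k) (K := C ⧸ m)
  let e : k ≃ₐ[k] C ⧸ m := AlgEquiv.ofBijective (Algebra.ofId k (C ⧸ m)) hb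
  refine ⟨e.symm.toAlgHom.comp (Ideal.Quotient.mkₐ k m), ?_⟩
  ext c
  rw [RingHom.mem_ker]
  change e.symm (Ideal.Quotient.mk m c) = 0 ↔ _
  rw [map_eq_zero_iff _ e.symm.injective, Ideal.Quotient.eq_zero_iff_mem]

theorem mk_algebraMap_eq_of_ker_eq {m : Ideal C} {φ : C →ₐ[k] k} (hφ : RingHom.ker φ = m) (c : C) :
    Ideal.Quotient.mk (fiberIdeal H m) (algebraMap C H c) = algebraMap k _ (φ c) := by
  have h : c - algebraMap k C (φ c) ∈ m := by
    rw [← hφ, RingHom.mem_ker]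
    simp
  have h' := Ideal.mem_map_of_mem (algebraMap C H) h
  rw [map_sub, ← IsScalarTower.algebraMap_apply] at h'
  exact Ideal.Quotient.eq.mpr h'

theorem finite_fiber [Module.Finite C H] {m : Ideal C} {φ : C →ₐ[k] k}
    (hφ : RingHom.ker φ = m) : Module.Finite k (Fiber H m) := by
  obtain ⟨Y, hY⟩ := Module.Finite.fg_top (R := C) (M := H)
  classical
  refine ⟨⟨Y.image (Ideal.Quotient.mk (fiberIdeal H m)), ?_⟩⟩
  rw [eq_top_iff]
  rintro x -
  obtain ⟨h, rfl⟩ := Ideal.Quotient.mk_surjective x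
  have hh : h ∈ Submodule.span C (Y : Set H) := hY ▸ Submodule.mem_top
  induction hh using Submodule.span_induction with
  | mem y hy => exact Submodule.subset_span (by simpa using ⟨y, hy, rfl⟩)
  | zero => rw [map_zero]; exact Submodule.zero_mem _
  | add x y _ _ hx hy => rw [map_add]; exact Submodule.add_mem _ hx hy
  | smul c x _ hx =>
    rw [Algebra.smul_def, map_mul, mk_algebraMap_eq_of_ker_eq k H hφ, ← Algebra.smul_def]
    exact Submodule.smul_mem _ _ hx

/-- By Nakayama's lemma, the fibers of a finite extension are nonzero. -/
theorem nontrivial_fiber [Module.Finite C H] (hinj : Function.Injective (algebraMap C H))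
    (m : Ideal C) [hm : m.IsMaximal] : Nontrivial (Fiber H m) := by
  rw [Ideal.Quotient.nontrivial_iff]
  intro htop
  have hle : (⊤ : Submodule C H) ≤ m • ⊤ := by
    intro x _
    have hx : x ∈ fiberIdeal H m := htop ▸ Submodule.mem_top
    unfold fiberIdeal Ideal.map at hx
    induction hx using Submodule.span_induction with
    | mem x hx =>
      obtain ⟨c, hc, rfl⟩ := hx
      rw [Algebra.algebraMap_eq_smul_one]
      exact Submodule.smul_mem_smul hc Submodule.mem_top
    | zero => exact Submodule.zero_mem _
    | add x y _ _ hx hy => exact Submodule.add_mem _ (hx trivial) (hy trivial)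
    | smul r x _ hx =>
      have hr := hx trivial
      clear hx
      refine Submodule.smul_induction_on hr (fun c hc y _ => ?_) (fun y z hy hz => ?_)
      · rw [smul_eq_mul, mul_smul_comm]
        exact Submodule.smul_mem_smul hc Submodule.mem_top
      · rw [smul_add]
        exact Submodule.add_mem _ hy hz
  obtain ⟨c, hc, hc0⟩ := Submodule.exists_sub_one_mem_and_smul_eq_zero_of_fg_of_le_smul m ⊤
    Module.Finite.fg_top hle
  have h0 : c = 0 := hinj (by
    rw [map_zero, Algebra.algebraMap_eq_smul_one, hc0 1 Submodule.mem_top])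
  rw [h0, zero_sub] at hc
  exact hm.ne_top ((Ideal.eq_top_iff_one m).2 (by simpa using m.neg_mem hc))

end Character

/-! ### Tensor products, spaces of linear maps and the descent to fibers -/

namespace AlgModule

section HopfModules

variable {k : Type u} {H : Type v} [Field k] [Ring H] [HopfAlgebra k H]

theorem tensor_act_tmul {ι : Type*} {h : H} (𝓡 : Coalgebra.Repr k h ι)
    (M : AlgModule.{u, v, w₁} k H) (N : AlgModule.{u, v, w₂} k H) (x : M) (y : N) :
    (M.tensor N).act h (x ⊗ₜ[k] y : M ⊗[k] N) =
      (∑ i ∈ 𝓡.index, M.act (𝓡.left i) x ⊗ₜ[k] N.act (𝓡.right i) y : M ⊗[k] N) := by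
  change Module.endTensorEndAlgHom (R := k) (S := k) (A := k)
    (Algebra.TensorProduct.map M.act N.act (Coalgebra.comul h)) (x ⊗ₜ[k] y) = _
  rw [← 𝓡.eq, map_sum, map_sum, LinearMap.sum_apply]
  rfl

/-- A linear map on a tensor product is a homomorphism as soon as it is one on pure tensors. -/
theorem isHom_tensor {M : AlgModule.{u, v, w₁} k H} {N : AlgModule.{u, v, w₂} k H}
    {P : AlgModule.{u, v, w} k H} (f : M ⊗[k] N →ₗ[k] P)
    (hf : ∀ (h : H) (x : M) (y : N),
      ∑ i ∈ (Coalgebra.Repr.arbitrary k h).index,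
        f (M.act ((Coalgebra.Repr.arbitrary k h).left i) x ⊗ₜ[k]
          N.act ((Coalgebra.Repr.arbitrary k h).right i) y) = P.act h (f (x ⊗ₜ[k] y))) :
    IsHom (M := M.tensor N) (N := P) f := by
  intro h z
  have hz : f ∘ₗ (M.tensor N).act h = P.act h ∘ₗ f := by
    refine TensorProduct.ext' fun x y => ?_
    change f ((M.tensor N).act h (x ⊗ₜ y)) = P.act h (f (x ⊗ₜ y))
    rw [← hf]
    have := tensor_act_tmul (Coalgebra.Repr.arbitrary k h) M N x y
    exact (congrArg f this).trans (map_sum f _ _)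
  exact LinearMap.congr_fun hz z

/-- The action of `H` on `Hom(V, W)` through `W`. -/
def postAct (V : AlgModule.{u, v, w₁} k H) (W : AlgModule.{u, v, w₂} k H) :
    H →ₐ[k] Module.End k (V →ₗ[k] W) where
  toFun h := LinearMap.compRight k (W.act h)
  map_one' := by ext; simp
  map_mul' a b := by ext; simp
  map_zero' := by ext; simp
  map_add' a b := by ext; simp
  commutes' r := by ext; simp

/-- The action of `H` on `Hom(V, W)` through the dual of `V`. -/
def preAct (V : AlgModule.{u, v, w₁} k H) (W : AlgModule.{u, v, w₂} k H) :
    H →ₐ[k] Module.End k (V →ₗ[k] W) where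
  toFun h := LinearMap.lcomp k W (V.act (HopfAlgebra.antipode k h))
  map_one' := by ext; simp
  map_mul' a b := by ext; simp [HopfAlgebra.antipode_mul_antidistrib]
  map_zero' := by ext; simp
  map_add' a b := by ext; simp
  commutes' r := by ext; simp [Algebra.algebraMap_eq_smul_one]

/-- The space of linear maps between two modules, on which `h` acts by `T ↦ ∑ h₁ T S(h₂)`. -/
def homMod (V : AlgModule.{u, v, w₁} k H) (W : AlgModule.{u, v, w₂} k H) :
    AlgModule.{u, v, max w₁ w₂} k H where
  carrier := V →ₗ[k] W
  act := (Algebra.TensorProduct.lift (postAct V W) (preAct V W) fun _ _ => rfl).comp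
    (Bialgebra.comulAlgHom k H)

theorem homMod_act {ι : Type*} {h : H} (𝓡 : Coalgebra.Repr k h ι)
    (V : AlgModule.{u, v, w₁} k H) (W : AlgModule.{u, v, w₂} k H) (T : V →ₗ[k] W) :
    (V.homMod W).act h T =
      (∑ i ∈ 𝓡.index, W.act (𝓡.left i) ∘ₗ T ∘ₗ V.act (HopfAlgebra.antipode k (𝓡.right i)) :
        V →ₗ[k] W) := by
  change Algebra.TensorProduct.lift (postAct V W) (preAct V W) (fun _ _ => rfl)
    (Coalgebra.comul h) T = _
  rw [← 𝓡.eq, map_sum, LinearMap.sum_apply]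
  rfl

/-- The isomorphism `W ⊗ V* ≅ Hom(V, W)` for finite dimensional `V`. -/
theorem tensor_dual_iso (V : AlgModule.{u, v, w₁} k H) (W : AlgModule.{u, v, w₂} k H)
    [Module.Finite k V] : (W.tensor V.dual).Iso (V.homMod W) := by
  let e : W ⊗[k] Module.Dual k V ≃ₗ[k] (V →ₗ[k] W) :=
    (TensorProduct.comm k W (Module.Dual k V)).trans (dualTensorHomEquiv k V W)
  refine ⟨e, ?_⟩
  refine isHom_tensor (M := W) (N := V.dual) (P := V.homMod W) e.toLinearMap fun h x ξ => ?_
  change _ = (V.homMod W).act h (e (x ⊗ₜ ξ))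
  rw [homMod_act (Coalgebra.Repr.arbitrary k h)]
  refine Finset.sum_congr rfl fun i _ => ?_
  refine LinearMap.ext fun y : V => ?_
  have h1 (η : Module.Dual k V) (z : W) (y : V) : dualTensorHom k V W (η ⊗ₜ z) y = η y • z :=
    dualTensorHom_apply _ _ _
  exact (h1 _ _ y).trans ((map_smul _ _ _).symm.trans
    (congrArg (W.act ((Coalgebra.Repr.arbitrary k h).left i)) (h1 ξ x _).symm))

/-- The Sweedler identity `∑ h₁ ⊗ S(h₂) h₃ = h ⊗ 1`. -/
theorem _root_.HopfAlgebra.sum_tmul_antipode_mul (h : H) :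
    ∑ i ∈ (Coalgebra.Repr.arbitrary k h).index,
      ∑ j ∈ (Coalgebra.Repr.arbitrary k ((Coalgebra.Repr.arbitrary k h).left i)).index,
        (Coalgebra.Repr.arbitrary k ((Coalgebra.Repr.arbitrary k h).left i)).left j ⊗ₜ[k]
          (HopfAlgebra.antipode k
            ((Coalgebra.Repr.arbitrary k ((Coalgebra.Repr.arbitrary k h).left i)).right j) *
              (Coalgebra.Repr.arbitrary k h).right i) = h ⊗ₜ[k] (1 : H) := by
  set 𝓡 := Coalgebra.Repr.arbitrary k h
  have h1 := Coalgebra.sum_tmul_tmul_eq 𝓡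
    (fun i => Coalgebra.Repr.arbitrary k (𝓡.left i)) (fun i => Coalgebra.Repr.arbitrary k (𝓡.right i))
  let F : H ⊗[k] (H ⊗[k] H) →ₗ[k] H ⊗[k] H := LinearMap.lTensor H
    (LinearMap.mul' k H ∘ₗ LinearMap.rTensor H (HopfAlgebra.antipode k))
  have h2 := congrArg F h1
  simp only [F, map_sum, LinearMap.lTensor_tmul, LinearMap.comp_apply, LinearMap.rTensor_tmul,
    LinearMap.mul'_apply] at h2
  rw [h2]
  have h3 : ∑ i ∈ 𝓡.index, Coalgebra.counit (R := k) (𝓡.right i) • 𝓡.left i = h := by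
    have := congrArg (TensorProduct.rid k H) (Coalgebra.sum_tmul_counit_eq 𝓡)
    simpa only [map_sum, TensorProduct.rid_tmul, one_smul] using this
  conv_rhs => rw [← h3]
  simp only [← TensorProduct.tmul_sum, HopfAlgebra.sum_antipode_mul_eq_smul,
    TensorProduct.sum_tmul, TensorProduct.tmul_smul, TensorProduct.smul_tmul']

/-- The evaluation `Hom(V, W) ⊗ V → W` is a homomorphism. -/
theorem isHom_eval (V : AlgModule.{u, v, w₁} k H) (W : AlgModule.{u, v, w₂} k H) :
    IsHom (M := (V.homMod W).tensor V) (N := W)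
      (TensorProduct.lift (LinearMap.id : (V →ₗ[k] W) →ₗ[k] V →ₗ[k] W)) := by
  refine isHom_tensor (M := V.homMod W) (N := V) (P := W) _ fun h T x => ?_
  change V →ₗ[k] W at T
  have h1 := HopfAlgebra.sum_tmul_antipode_mul (k := k) h
  let F : H ⊗[k] H →ₗ[k] W := TensorProduct.lift
    (((LinearMap.llcomp k V W W).flip T) ∘ₗ W.act.toLinearMap |>.compl₂
      ((LinearMap.applyₗ x) ∘ₗ V.act.toLinearMap))
  have hF (a b : H) : F (a ⊗ₜ b) = W.act a (T (V.act b x)) := rfl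
  have h2 := congrArg F h1
  simp only [map_sum, hF, map_one, Module.End.one_apply] at h2
  change _ = W.act h (T x)
  rw [← h2]
  refine Finset.sum_congr rfl fun i _ => ?_
  change (show V →ₗ[k] W from (V.homMod W).act _ T) (V.act _ x) = _
  rw [homMod_act (Coalgebra.Repr.arbitrary k _), LinearMap.sum_apply]
  refine Finset.sum_congr rfl fun j _ => ?_
  simp

end HopfModules

section Inflation

variable {k : Type u} {C : Type w} {H : Type v} [Field k] [CommRing C] [Ring H] [HopfAlgebra k H]
  [Algebra C H]

theorem isStable_inflate_iff {m : Ideal C} (M : AlgModule.{u, v, w₁} k (Fiber H m))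
    (N : Submodule k M) : M.inflate.IsStable N ↔ M.IsStable N := by
  constructor
  · intro h a
    obtain ⟨a, rfl⟩ := Ideal.Quotient.mk_surjective a
    exact h a
  · exact fun h a => h _

theorem isIrreducible_inflate_iff {m : Ideal C} (M : AlgModule.{u, v, w₁} k (Fiber H m)) :
    M.inflate.IsIrreducible ↔ M.IsIrreducible := by
  rw [isIrreducible_iff, isIrreducible_iff]
  exact and_congr Iff.rfl (forall_congr' fun N => imp_congr_left (isStable_inflate_iff M N))

theorem isHom_inflate_iff {m : Ideal C} {M : AlgModule.{u, v, w₁} k (Fiber H m)}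
    {N : AlgModule.{u, v, w₂} k (Fiber H m)} (f : M →ₗ[k] N) :
    IsHom (M := M.inflate) (N := N.inflate) f ↔ IsHom f := by
  constructor
  · intro h a
    obtain ⟨a, rfl⟩ := Ideal.Quotient.mk_surjective a
    exact h a
  · exact fun h a => h _

theorem inflate_iso_iff {m : Ideal C} {M : AlgModule.{u, v, w₁} k (Fiber H m)}
    {N : AlgModule.{u, v, w₂} k (Fiber H m)} : M.inflate.Iso N.inflate ↔ M.Iso N :=
  exists_congr fun e => isHom_inflate_iff (M := M) (N := N) e.toLinearMap

end Inflation

section Descent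

variable {k : Type u} {C : Type w} {H : Type v} [Field k] [CommRing C] [HopfAlgebra k C]
  [Ring H] [HopfAlgebra k H] [Algebra C H] [IsScalarTower k C H]

/-- The central subalgebra `C` acts on the module by the character `φ`. -/
def HasCentralCharacter (M : AlgModule.{u, v, w₁} k H) (φ : C →ₐ[k] k) : Prop :=
  ∀ c : C, M.act (algebraMap C H c) = algebraMap k _ (φ c)

theorem inflate_hasCentralCharacter {m : Ideal C} {φ : C →ₐ[k] k} (hφ : RingHom.ker φ = m)
    (M : AlgModule.{u, v, w₁} k (Fiber H m)) : M.inflate.HasCentralCharacter φ := by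
  intro c
  change M.act (Ideal.Quotient.mk (fiberIdeal H m) (algebraMap C H c)) = _
  rw [mk_algebraMap_eq_of_ker_eq k H hφ, AlgHom.commutes]
  rfl

/-- A module of `H` with central character `φ`, as a module of the fiber at the kernel of `φ`. -/
def descend {m : Ideal C} {φ : C →ₐ[k] k} (hφ : RingHom.ker φ = m) (M : AlgModule.{u, v, w₁} k H)
    (hM : M.HasCentralCharacter φ) : AlgModule.{u, v, w₁} k (Fiber H m) where
  carrier := M
  act := Ideal.Quotient.liftₐ (fiberIdeal H m) M.act (by
    have hle : fiberIdeal H m ≤ RingHom.ker M.act := by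
      refine Ideal.map_le_iff_le_comap.mpr fun c hc => ?_
      rw [← hφ, RingHom.mem_ker] at hc
      rw [Ideal.mem_comap, RingHom.mem_ker, hM c, hc, map_zero]
    exact fun a ha => hle ha)

variable [IsCentralHopfSubalgebra k C H]

/-- The comultiplication of `H` on `C`, in Sweedler notation. -/
theorem _root_.comul_algebraMap_repr (c : C) :
    ∑ i ∈ (Coalgebra.Repr.arbitrary k c).index,
      algebraMap C H ((Coalgebra.Repr.arbitrary k c).left i) ⊗ₜ[k]
        algebraMap C H ((Coalgebra.Repr.arbitrary k c).right i) =
      Coalgebra.comul (R := k) (algebraMap C H c) := by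
  rw [IsCentralHopfSubalgebra.comul_algebraMap]
  conv_rhs => rw [← (Coalgebra.Repr.arbitrary k c).eq]
  rw [map_sum]
  rfl

/-- If `C` acts on `V` and `W` by the same character, then it acts on `Hom(V, W)` by the counit. -/
theorem HasCentralCharacter.homMod {V : AlgModule.{u, v, w₁} k H} {W : AlgModule.{u, v, w₂} k H}
    {φ : C →ₐ[k] k} (hV : V.HasCentralCharacter φ) (hW : W.HasCentralCharacter φ) :
    (V.homMod W).HasCentralCharacter (Bialgebra.counitAlgHom k C) := by
  intro c
  refine LinearMap.ext fun T => ?_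
  change V →ₗ[k] W at T
  let 𝓡 := Coalgebra.Repr.arbitrary k c
  let 𝓡' : Coalgebra.Repr k (algebraMap C H c) _ :=
    ⟨𝓡.index, _, _, comul_algebraMap_repr c⟩
  rw [homMod_act 𝓡']
  have h1 (i : _) : W.act (𝓡'.left i) ∘ₗ T ∘ₗ V.act (HopfAlgebra.antipode k (𝓡'.right i)) =
      φ (𝓡.left i * HopfAlgebra.antipode k (𝓡.right i)) • T := by
    change W.act (algebraMap C H (𝓡.left i)) ∘ₗ T ∘ₗ
      V.act (HopfAlgebra.antipode k (algebraMap C H (𝓡.right i))) = _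
    rw [IsCentralHopfSubalgebra.antipode_algebraMap, hV, hW, map_mul]
    ext x
    simp [mul_smul, smul_comm (φ (𝓡.left i))]
  rw [Finset.sum_congr rfl fun i _ => h1 i, ← Finset.sum_smul, ← map_sum,
    HopfAlgebra.sum_mul_antipode_eq_algebraMap_counit 𝓡, AlgHom.commutes]
  rfl

end Descent

end AlgModule

/-! ### Irreducible modules of a fiber as quotients and submodules of tensor products -/

namespace AlgModule

section Codual

variable {k : Type u} {A : Type v} [Field k] [Ring A] [HopfAlgebra k A] [Module.Finite k A]

variable (k A) in
/-- The inverse of the antipode of a finite dimensional Hopf algebra. -/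
def _root_.HopfAlgebra.antipodeInv : A →ₗ[k] A :=
  (LinearEquiv.ofBijective (HopfAlgebra.antipode k) HopfAlgebra.antipode_bijective).symm.toLinearMap

theorem _root_.HopfAlgebra.antipode_antipodeInv (a : A) :
    HopfAlgebra.antipode k (HopfAlgebra.antipodeInv k A a) = a :=
  (LinearEquiv.ofBijective (HopfAlgebra.antipode k)
    (HopfAlgebra.antipode_bijective (k := k) (A := A))).apply_symm_apply a

theorem _root_.HopfAlgebra.antipodeInv_antipode (a : A) :
    HopfAlgebra.antipodeInv k A (HopfAlgebra.antipode k a) = a :=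
  (LinearEquiv.ofBijective (HopfAlgebra.antipode k)
    (HopfAlgebra.antipode_bijective (k := k) (A := A))).symm_apply_apply a

theorem _root_.HopfAlgebra.antipodeInv_mul (a b : A) : HopfAlgebra.antipodeInv k A (a * b) =
    HopfAlgebra.antipodeInv k A b * HopfAlgebra.antipodeInv k A a := by
  apply (HopfAlgebra.antipode_bijective (k := k) (A := A)).1
  rw [HopfAlgebra.antipode_mul_antidistrib]
  simp only [HopfAlgebra.antipode_antipodeInv]

theorem _root_.HopfAlgebra.antipodeInv_one : HopfAlgebra.antipodeInv k A (1 : A) = 1 := by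
  apply (HopfAlgebra.antipode_bijective (k := k) (A := A)).1
  rw [HopfAlgebra.antipode_antipodeInv, HopfAlgebra.antipode_one]

/-- The identity `∑ a₂ S⁻¹(a₁) = ε(a)`. -/
theorem _root_.HopfAlgebra.sum_mul_antipodeInv {ι : Type*} {a : A} (𝓡 : Coalgebra.Repr k a ι) :
    ∑ i ∈ 𝓡.index, 𝓡.right i * HopfAlgebra.antipodeInv k A (𝓡.left i) =
      Coalgebra.counit (R := k) a • (1 : A) := by
  apply (HopfAlgebra.antipode_bijective (k := k) (A := A)).1
  rw [map_sum, map_smul, HopfAlgebra.antipode_one]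
  simp only [HopfAlgebra.antipode_mul_antidistrib, HopfAlgebra.antipode_antipodeInv]
  exact HopfAlgebra.sum_mul_antipode_eq_smul 𝓡

/-- The right dual of a module: the dual vector space with `⟨a ξ, x⟩ = ⟨ξ, S⁻¹(a) x⟩`. -/
def codual (M : AlgModule.{u, v, w} k A) : AlgModule.{u, v, max u w} k A where
  carrier := Module.Dual k M
  act :=
    { toFun := fun a => (M.act (HopfAlgebra.antipodeInv k A a)).dualMap
      map_one' := by ext ξ x; simp [HopfAlgebra.antipodeInv_one]
      map_mul' := fun a b => by ext ξ x; simp [HopfAlgebra.antipodeInv_mul]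
      map_zero' := by ext ξ x; simp
      map_add' := fun a b => by ext ξ x; simp
      commutes' := fun r => by
        ext ξ x; simp [Algebra.algebraMap_eq_smul_one, HopfAlgebra.antipodeInv_one] }

/-- A stable subspace of the dual is the annihilator of a stable subspace. -/
theorem IsIrreducible.codual {M : AlgModule.{u, v, w} k A} (hM : M.IsIrreducible) :
    M.codual.IsIrreducible := by
  have := hM.finite
  have := hM.nontrivial
  refine (isIrreducible_iff _).2
    ⟨inferInstanceAs (Nontrivial (Module.Dual k M)), fun N hN => ?_⟩
  change Submodule k (Module.Dual k M) at N
  have hst : M.IsStable N.dualCoannihilator := by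
    intro a x hx
    rw [Submodule.mem_dualCoannihilator] at hx ⊢
    intro ξ hξ
    have h := hx _ (hN (HopfAlgebra.antipode k a) ξ hξ)
    change ξ (M.act (HopfAlgebra.antipodeInv k A (HopfAlgebra.antipode k a)) x) = 0 at h
    rwa [HopfAlgebra.antipodeInv_antipode] at h
  have hN' : N.dualCoannihilator.dualAnnihilator = N := Subspace.dualCoannihilator_dualAnnihilator_eq
  rcases hM.eq_bot_or_eq_top hst with h | h
  · right
    rw [h, Submodule.dualAnnihilator_bot] at hN'
    exact hN'.symm
  · left
    rw [h, Submodule.dualAnnihilator_top] at hN'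
    exact hN'.symm

end Codual

section Tensor

variable {k : Type u} {H : Type v} [Field k] [Ring H] [HopfAlgebra k H]

theorem IsHom.rTensor {M : AlgModule.{u, v, w₁} k H} {M' : AlgModule.{u, v, w₂} k H}
    {f : M →ₗ[k] M'} (hf : IsHom f) (N : AlgModule.{u, v, w} k H) :
    IsHom (M := M.tensor N) (N := M'.tensor N) (LinearMap.rTensor N f) := by
  refine isHom_tensor (M := M) (N := N) (P := M'.tensor N) (LinearMap.rTensor N f)
    fun h x y => ?_
  have h1 := tensor_act_tmul (Coalgebra.Repr.arbitrary k h) M' N (f x) y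
  refine Eq.trans ?_ h1.symm
  refine Finset.sum_congr rfl fun i _ => ?_
  rw [← hf]
  rfl

end Tensor

section Fibers

variable {k : Type u} {C : Type w} {H : Type v} [Field k]
  [CommRing C] [HopfAlgebra k C] [Ring H] [HopfAlgebra k H] [Algebra C H] [IsScalarTower k C H]
  [IsCentralHopfSubalgebra k C H]

/-- The irreducible `W` is a quotient of `M' ⊗ V` for every irreducible `M' ⊆ Hom(V, W)`. -/
theorem exists_isQuotientOf {m : Ideal C} {φ : C →ₐ[k] k} (hφ : RingHom.ker φ = m)
    [Module.Finite k (Fiber H m)] (V W : IrrModule k (Fiber H m)) :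
    ∃ M' : IrrModule k (IdentityFiber k C H),
      W.1.inflate.IsQuotientOf (M'.1.inflate.tensor V.1.inflate) := by
  have hVf : Module.Finite k V.1.inflate := V.2.finite
  have hWf : Module.Finite k W.1.inflate := W.2.finite
  have hVn : Nontrivial V.1.inflate := V.2.nontrivial
  have hWn : Nontrivial W.1.inflate := W.2.nontrivial
  let E := V.1.inflate.homMod W.1.inflate
  have hE : E.HasCentralCharacter (Bialgebra.counitAlgHom k C) :=
    (inflate_hasCentralCharacter hφ V.1).homMod (inflate_hasCentralCharacter hφ W.1)
  let D : AlgModule k (IdentityFiber k C H) := descend rfl E hE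
  have hDf : Module.Finite k D :=
    inferInstanceAs (Module.Finite k (V.1.inflate →ₗ[k] W.1.inflate))
  have hDn : Nontrivial D := inferInstanceAs (Nontrivial (V.1.inflate →ₗ[k] W.1.inflate))
  obtain ⟨N, hN, hirr⟩ := D.exists_irreducible_sub
  let i : N →ₗ[k] (V.1.inflate →ₗ[k] W.1.inflate) := N.subtype
  have hi : IsHom (M := (D.sub N hN).inflate) (N := E) i := fun _ _ => rfl
  let ev : (V.1.inflate →ₗ[k] W.1.inflate) ⊗[k] V.1.inflate →ₗ[k] W.1.inflate :=
    TensorProduct.lift LinearMap.id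
  have hev : IsHom (M := E.tensor V.1.inflate) (N := W.1.inflate) ev := isHom_eval _ _
  let f : N ⊗[k] V.1.inflate →ₗ[k] W.1.inflate := ev ∘ₗ LinearMap.rTensor _ i
  have hf : IsHom (M := (D.sub N hN).inflate.tensor V.1.inflate) (N := W.1.inflate) f := by
    intro h z
    exact (congrArg ev (hi.rTensor V.1.inflate h z)).trans (hev h _)
  refine ⟨⟨D.sub N hN, hirr⟩, f, hf, hf.surjective ((isIrreducible_inflate_iff _).2 W.2) ?_⟩
  have hNn : Nontrivial N := hirr.nontrivial
  obtain ⟨T, hT⟩ := exists_ne (0 : N)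
  intro h0
  apply hT
  apply Subtype.ext
  refine LinearMap.ext fun x : V.1.inflate => ?_
  exact LinearMap.congr_fun h0 (T ⊗ₜ[k] x)

/-- The Sweedler identity `∑ h₂ S⁻¹(h₁) ⊗ h₃ = 1 ⊗ h`, with the first factor in the identity
fiber. -/
theorem sum_mul_antipodeInv_tmul [Module.Finite k (IdentityFiber k C H)] (h : H) :
    ∑ i ∈ (Coalgebra.Repr.arbitrary k h).index,
      ∑ j ∈ (Coalgebra.Repr.arbitrary k ((Coalgebra.Repr.arbitrary k h).right i)).index,
        ((Ideal.Quotient.mk _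
            ((Coalgebra.Repr.arbitrary k ((Coalgebra.Repr.arbitrary k h).right i)).left j) *
          HopfAlgebra.antipodeInv k (IdentityFiber k C H)
            (Ideal.Quotient.mk _ ((Coalgebra.Repr.arbitrary k h).left i)) :
              IdentityFiber k C H)) ⊗ₜ[k]
          (Coalgebra.Repr.arbitrary k ((Coalgebra.Repr.arbitrary k h).right i)).right j =
      (1 : IdentityFiber k C H) ⊗ₜ[k] h := by
  set 𝓡 := Coalgebra.Repr.arbitrary k h
  have h1 := Coalgebra.sum_tmul_tmul_eq 𝓡
    (fun i => Coalgebra.Repr.arbitrary k (𝓡.left i)) (fun i => Coalgebra.Repr.arbitrary k (𝓡.right i))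
  let q : H →ₐ[k] IdentityFiber k C H := Ideal.Quotient.mkₐ k _
  let G : H ⊗[k] H →ₗ[k] IdentityFiber k C H := LinearMap.mul' k _ ∘ₗ
    (TensorProduct.comm k _ _).toLinearMap ∘ₗ
      TensorProduct.map (HopfAlgebra.antipodeInv k _ ∘ₗ q.toLinearMap) q.toLinearMap
  let F : H ⊗[k] (H ⊗[k] H) →ₗ[k] IdentityFiber k C H ⊗[k] H :=
    LinearMap.rTensor H G ∘ₗ (TensorProduct.assoc k H H H).symm.toLinearMap
  have hF (x y z : H) : F (x ⊗ₜ (y ⊗ₜ z)) =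
      (q y * HopfAlgebra.antipodeInv k (IdentityFiber k C H) (q x)) ⊗ₜ z := rfl
  have h2 := congrArg F h1
  simp only [map_sum, hF] at h2
  refine Eq.trans h2.symm ?_
  have h3 (i : _) := HopfAlgebra.sum_mul_antipodeInv (k := k) (A := IdentityFiber k C H)
    (a := q (𝓡.left i)) ⟨(Coalgebra.Repr.arbitrary k (𝓡.left i)).index,
      fun j => q ((Coalgebra.Repr.arbitrary k (𝓡.left i)).left j),
      fun j => q ((Coalgebra.Repr.arbitrary k (𝓡.left i)).right j), by
        change _ = TensorProduct.map q.toLinearMap q.toLinearMap (Coalgebra.comul (𝓡.left i))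
        conv_rhs => rw [← (Coalgebra.Repr.arbitrary k (𝓡.left i)).eq]
        rw [map_sum]
        rfl⟩
  have h4 (a : H) : Coalgebra.counit (R := k) (q a) = Coalgebra.counit (R := k) a := rfl
  simp only [h4] at h3
  simp only [← TensorProduct.sum_tmul, h3]
  simp only [TensorProduct.smul_tmul, ← TensorProduct.tmul_sum]
  rw [Coalgebra.sum_counit_smul]

/-- If `V` is a quotient of `M' ⊗ W`, then `W` is a submodule of `M'' ⊗ V` for the right dual `M''`
of `M'`. -/
theorem exists_isSubmoduleOf {m : Ideal C} {φ : C →ₐ[k] k} (hφ : RingHom.ker φ = m)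
    [Module.Finite k (Fiber H m)] [Module.Finite k (IdentityFiber k C H)]
    (V W : IrrModule k (Fiber H m)) :
    ∃ M'' : IrrModule k (IdentityFiber k C H),
      W.1.inflate.IsSubmoduleOf (M''.1.inflate.tensor V.1.inflate) := by
  obtain ⟨M, f, hf, hsurj⟩ := exists_isQuotientOf hφ W V
  have hMf : Module.Finite k M.1 := M.2.finite
  have hVn : Nontrivial V.1.inflate := V.2.nontrivial
  change M.1 ⊗[k] W.1 →ₗ[k] V.1 at f
  let e : Module.Dual k M.1 ⊗[k] V.1 ≃ₗ[k] (M.1 →ₗ[k] V.1) := dualTensorHomEquiv k M.1 V.1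
  -- the homomorphism `w ↦ f (- ⊗ w)`
  let g : W.1 →ₗ[k] Module.Dual k M.1 ⊗[k] V.1 :=
    e.symm.toLinearMap ∘ₗ (TensorProduct.curry f).flip
  have hg (y : W.1) (x : M.1) : e (g y) x = f (x ⊗ₜ y) := by
    change e (e.symm _) x = _
    rw [e.apply_symm_apply]
    rfl
  have he (h : H) (z : Module.Dual k M.1 ⊗[k] V.1) (x : M.1) :
      e ((M.1.codual.inflate.tensor V.1.inflate).act h z) x =
        ∑ i ∈ (Coalgebra.Repr.arbitrary k h).index,
          V.1.inflate.act ((Coalgebra.Repr.arbitrary k h).right i)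
            (e z (M.1.act (HopfAlgebra.antipodeInv k (IdentityFiber k C H)
              (Ideal.Quotient.mk _ ((Coalgebra.Repr.arbitrary k h).left i))) x)) := by
    have he1 (η : Module.Dual k M.1) (z : V.1) (x : M.1) : e (η ⊗ₜ z) x = η x • z :=
      dualTensorHom_apply _ _ _
    induction z with
    | zero =>
      refine Eq.trans ?_ (Finset.sum_eq_zero fun i _ => ?_).symm
      · exact LinearMap.congr_fun ((congrArg e (map_zero _)).trans (map_zero e)) x
      · rw [map_zero]
        exact map_zero _
    | tmul ξ y =>
      have h1 := tensor_act_tmul (Coalgebra.Repr.arbitrary k h) M.1.codual.inflate V.1.inflate ξ y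
      refine (LinearMap.congr_fun ((congrArg e h1).trans (map_sum e _ _)) x).trans ?_
      rw [LinearMap.sum_apply]
      refine Finset.sum_congr rfl fun i _ => ?_
      exact (he1 _ _ x).trans ((map_smul _ _ _).symm.trans (congrArg _ (he1 ξ y _).symm))
    | add z z' hz hz' =>
      have h1 : e ((M.1.codual.inflate.tensor V.1.inflate).act h (z + z')) =
          e ((M.1.codual.inflate.tensor V.1.inflate).act h z) +
            e ((M.1.codual.inflate.tensor V.1.inflate).act h z') :=
        (congrArg e (map_add _ _ _)).trans (map_add e _ _)
      rw [h1, LinearMap.add_apply, hz, hz']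
      refine Finset.sum_add_distrib.symm.trans (Finset.sum_congr rfl fun i _ => ?_)
      rw [map_add, LinearMap.add_apply]
      exact (map_add _ _ _).symm
  have hgh : IsHom (M := W.1.inflate) (N := M.1.codual.inflate.tensor V.1.inflate) g := by
    intro h y
    apply e.injective
    refine LinearMap.ext fun x : M.1 => ?_
    refine Eq.trans ?_ (he h (g y) x).symm
    refine (hg _ x).trans ?_
    have h1 := sum_mul_antipodeInv_tmul (k := k) (C := C) h
    let F : IdentityFiber k C H ⊗[k] H →ₗ[k] V.1 := f ∘ₗ TensorProduct.map
      ((LinearMap.applyₗ x) ∘ₗ M.1.act.toLinearMap)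
      ((LinearMap.applyₗ y) ∘ₗ W.1.inflate.act.toLinearMap)
    have hF (a : IdentityFiber k C H) (b : H) :
      F (a ⊗ₜ b) = f (M.1.act a x ⊗ₜ W.1.inflate.act b y) := rfl
    have h2 := congrArg F h1
    simp only [map_sum, hF, map_one, map_mul, Module.End.one_apply, Module.End.mul_apply] at h2
    refine h2.symm.trans (Finset.sum_congr rfl fun i _ => ?_)
    refine Eq.trans ?_ (congrArg (V.1.inflate.act _) (hg y _).symm)
    refine Eq.trans ?_ (hf ((Coalgebra.Repr.arbitrary k h).right i) _)
    have h3 := tensor_act_tmul (Coalgebra.Repr.arbitrary k ((Coalgebra.Repr.arbitrary k h).right i))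
      M.1.inflate W.1.inflate (M.1.act (HopfAlgebra.antipodeInv k (IdentityFiber k C H)
              (Ideal.Quotient.mk _ ((Coalgebra.Repr.arbitrary k h).left i))) x) y
    exact ((congrArg f h3).trans (map_sum f _ _)).symm
  refine ⟨⟨M.1.codual, M.2.codual⟩, g, hgh,
    hgh.injective ((isIrreducible_inflate_iff _).2 W.2) fun h0 => ?_⟩
  obtain ⟨v, hv⟩ := exists_ne (0 : V.1.inflate)
  have hf0 : f = 0 := TensorProduct.ext' fun x y => by
    rw [← hg, h0]
    exact LinearMap.congr_fun (map_zero e) x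
  obtain ⟨z, hz⟩ := hsurj v
  apply hv
  rw [← hz]
  exact LinearMap.congr_fun hf0 z

end Fibers

end AlgModule

/-! ### Twisting by characters, and weight vectors -/

namespace HopfAlgebra

open WithConv LinearMap

variable {k : Type u} {H : Type v} [Field k] [Ring H] [HopfAlgebra k H]
  {E : Type w} [Ring E] [Algebra k E]

/-- The winding endomorphism `h ↦ ∑ χ(h₁) h₂` given by a character `χ`. -/
def twist (χ : H →ₐ[k] k) : H →ₐ[k] H :=
  (Algebra.TensorProduct.lift ((Algebra.ofId k H).comp χ) (AlgHom.id k H)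
    (fun _ _ => Algebra.commute_algebraMap_left _ _)).comp (Bialgebra.comulAlgHom k H)

theorem twist_apply {ι : Type*} {h : H} (𝓡 : Coalgebra.Repr k h ι) (χ : H →ₐ[k] k) :
    twist χ h = ∑ i ∈ 𝓡.index, χ (𝓡.left i) • 𝓡.right i := by
  change Algebra.TensorProduct.lift ((Algebra.ofId k H).comp χ) (AlgHom.id k H)
    (fun _ _ => Algebra.commute_algebraMap_left _ _) (Coalgebra.comul h) = _
  rw [← 𝓡.eq, map_sum]
  refine Finset.sum_congr rfl fun i _ => ?_
  exact (Algebra.TensorProduct.lift_tmul _ _ _ _ _).trans (Algebra.smul_def _ _).symm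

variable (E) in
/-- A scalar-valued linear map as an element of the convolution algebra of maps to `E`. -/
def scalarConv (χ : H →ₗ[k] k) : WithConv (H →ₗ[k] E) := toConv (Algebra.linearMap k E ∘ₗ χ)

/-- The image of an element of `E` in the convolution algebra of maps `H → E`. -/
def constConv (T : E) : WithConv (H →ₗ[k] E) :=
  toConv (LinearMap.toSpanSingleton k E T ∘ₗ Coalgebra.counit)

theorem mul_constConv (f : WithConv (H →ₗ[k] E)) (T : E) (h : H) :
    (f * constConv T : WithConv (H →ₗ[k] E)) h = f h * T := by
  have hh := Coalgebra.sum_tmul_counit_eq (Coalgebra.Repr.arbitrary k h)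
  have h2 := congrArg (TensorProduct.rid k H) hh
  simp only [map_sum, TensorProduct.rid_tmul, one_smul] at h2
  rw [(Coalgebra.Repr.arbitrary k h).convMul_apply]
  conv_rhs => rw [← h2, map_sum, Finset.sum_mul]
  refine Finset.sum_congr rfl fun i _ => ?_
  rw [map_smul, smul_mul_assoc, ← mul_smul_comm]
  rfl

theorem constConv_mul (f : WithConv (H →ₗ[k] E)) (T : E) (h : H) :
    (constConv T * f : WithConv (H →ₗ[k] E)) h = T * f h := by
  have h2 := Coalgebra.sum_counit_smul (Coalgebra.Repr.arbitrary k h)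
  rw [(Coalgebra.Repr.arbitrary k h).convMul_apply]
  conv_rhs => rw [← h2, map_sum, Finset.mul_sum]
  refine Finset.sum_congr rfl fun i _ => ?_
  rw [map_smul, mul_smul_comm, ← smul_mul_assoc]
  rfl

theorem toConv_comp_twist (ρ : H →ₐ[k] E) (χ : H →ₐ[k] k) :
    toConv (ρ.toLinearMap ∘ₗ (twist χ).toLinearMap) =
      scalarConv E χ.toLinearMap * toConv ρ.toLinearMap := by
  ext h
  rw [(Coalgebra.Repr.arbitrary k h).convMul_apply]
  change ρ (twist χ h) = _
  rw [twist_apply (Coalgebra.Repr.arbitrary k h), map_sum]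
  refine Finset.sum_congr rfl fun i _ => ?_
  rw [map_smul, Algebra.smul_def]
  rfl

/-- The two ways of saying that `T` has weight `χ` for the adjoint action of `H` on `E`: as an
identity `ρ * T * ρ⁻¹ = χ T`, or equivalently `ρ * T = T * (χ * ρ)`, in the convolution algebra. -/
theorem adjoint_weight_iff (ρ : H →ₐ[k] E) (χ : H →ₐ[k] k) (T : E) :
    (∀ h, (toConv ρ.toLinearMap * constConv T * toConv (ρ.toLinearMap ∘ₗ antipode k) :
        WithConv (H →ₗ[k] E)) h = χ h • T) ↔ ∀ h, ρ h * T = T * ρ (twist χ h) := by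
  have comp (x y : WithConv (H →ₗ[k] H)) (hxy : x * y = 1) :
      toConv (ρ.toLinearMap ∘ₗ x.ofConv) * toConv (ρ.toLinearMap ∘ₗ y.ofConv) = 1 := by
    have := algHom_comp_convMul_distrib (R := k) ρ x y
    rw [hxy] at this
    apply ofConv_injective
    rw [← this]
    ext a
    simp
  have h1 : toConv ρ.toLinearMap * toConv (ρ.toLinearMap ∘ₗ antipode k) = 1 :=
    comp (toConv LinearMap.id) (toConv (antipode k)) id_mul_antipode
  have h2 : toConv (ρ.toLinearMap ∘ₗ antipode k) * toConv ρ.toLinearMap = 1 :=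
    comp (toConv (antipode k)) (toConv LinearMap.id) antipode_mul_id
  have hcomm : constConv T * scalarConv E χ.toLinearMap =
      scalarConv E χ.toLinearMap * constConv T := by
    ext h
    change (_ * _ : WithConv (H →ₗ[k] E)) h = (_ * _ : WithConv (H →ₗ[k] E)) h
    rw [mul_constConv, constConv_mul]
    exact (Algebra.commutes _ _).symm
  have ha : (∀ h, (toConv ρ.toLinearMap * constConv T *
      toConv (ρ.toLinearMap ∘ₗ antipode k) : WithConv (H →ₗ[k] E)) h = χ h • T) ↔
      toConv ρ.toLinearMap * constConv T * toConv (ρ.toLinearMap ∘ₗ antipode k) =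
        scalarConv E χ.toLinearMap * constConv T := by
    constructor
    · intro h
      ext a
      refine (h a).trans ?_
      refine Eq.trans ?_ (mul_constConv (scalarConv E χ.toLinearMap) T a).symm
      exact Algebra.smul_def _ _
    · intro h a
      rw [h, mul_constConv]
      exact (Algebra.smul_def _ _).symm
  have hb : (∀ h, ρ h * T = T * ρ (twist χ h)) ↔ toConv ρ.toLinearMap * constConv T =
      constConv T * toConv (ρ.toLinearMap ∘ₗ (twist χ).toLinearMap) := by
    constructor
    · intro h
      ext a
      refine (mul_constConv _ T a).trans ((h a).trans ?_)
      exact (constConv_mul (toConv (ρ.toLinearMap ∘ₗ (twist χ).toLinearMap)) T a).symm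
    · intro h a
      have := congrArg (fun f : WithConv (H →ₗ[k] E) => f a) h
      simp only [mul_constConv, constConv_mul] at this
      exact this
  rw [ha, hb, toConv_comp_twist, ← mul_assoc, hcomm]
  constructor
  · intro h
    rw [← h, mul_assoc, h2, mul_one]
  · intro h
    rw [h, mul_assoc, h1, mul_one]

end HopfAlgebra

namespace AlgModule

section Weights

variable {k : Type u} {H : Type v} [Field k] [Ring H] [HopfAlgebra k H]

/-- An endomorphism `T` has weight `χ` for the adjoint action if and only if it is a homomorphism
from the twist of `V` by `χ` to `V`. -/
theorem homMod_weight_iff (V : AlgModule.{u, v, w} k H) (χ : H →ₐ[k] k) (T : V →ₗ[k] V) :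
    (∀ h, (V.homMod V).act h T = (χ h • T : V →ₗ[k] V)) ↔
      ∀ h x, V.act h (T x) = T (V.act (HopfAlgebra.twist χ h) x) := by
  have h1 := HopfAlgebra.adjoint_weight_iff V.act χ T
  have h2 (h : H) : (V.homMod V).act h T =
      (WithConv.toConv V.act.toLinearMap * HopfAlgebra.constConv T *
        WithConv.toConv (V.act.toLinearMap ∘ₗ HopfAlgebra.antipode k) :
          WithConv (H →ₗ[k] Module.End k V)) h := by
    rw [homMod_act (Coalgebra.Repr.arbitrary k h),
      (Coalgebra.Repr.arbitrary k h).convMul_apply]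
    refine Finset.sum_congr rfl fun i _ => ?_
    rw [HopfAlgebra.mul_constConv]
    rfl
  refine Iff.trans (forall_congr' fun h => ?_) (h1.trans (forall_congr' fun h => ?_))
  · rw [h2]
    rfl
  · exact LinearMap.ext_iff

/-- Vectors with distinct weights are linearly independent, because distinct characters are. -/
theorem linearIndependent_of_weights {ι : Type*} (M : AlgModule.{u, v, w} k H)
    {χ : ι → H →ₐ[k] k} (hχ : Function.Injective χ) {T : ι → M} (h0 : ∀ i, T i ≠ 0)
    (hT : ∀ i h, M.act h (T i) = χ i h • T i) : LinearIndependent k T := by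
  rw [linearIndependent_iff']
  intro s g hg i hi
  have hind : LinearIndependent k (fun i => (χ i : H → k)) :=
    (linearIndependent_monoidHom H k).comp (fun i => ((χ i : H →ₐ[k] k) : H →* k)) fun i j hij =>
      hχ (AlgHom.ext fun h => DFunLike.congr_fun hij h)
  have h1 (f : Module.Dual k M) : g i * f (T i) = 0 := by
    refine linearIndependent_iff'.1 hind s (fun j => g j * f (T j)) ?_ i hi
    funext h
    have h2 := congrArg (fun x => f (M.act h x)) hg
    simp only [map_sum, map_smul, hT, map_zero, smul_eq_mul] at h2
    rw [Finset.sum_apply, Pi.zero_apply, ← h2]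
    refine Finset.sum_congr rfl fun j _ => ?_
    simp only [Pi.smul_apply, smul_eq_mul]
    ring
  by_contra hne
  refine h0 i ((Module.forall_dual_apply_eq_zero_iff k (T i)).1 fun f => ?_)
  exact (mul_eq_zero.1 (h1 f)).resolve_left hne

end Weights

end AlgModule

/-! ### The action of the group of characters of the identity fiber -/

namespace G₀

variable {k : Type u} {C : Type w} {H : Type v} [Field k] [CommRing C] [HopfAlgebra k C]
  [Ring H] [HopfAlgebra k H] [Algebra C H] [IsScalarTower k C H] [IsCentralHopfSubalgebra k C H]

/-- An element of `G₀`, as a character of `H`. -/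
def char (χ : G₀ k C H) : H →ₐ[k] k := χ.toAlgHom.comp (Ideal.Quotient.mkₐ k _)

theorem char_injective : Function.Injective (char : G₀ k C H → H →ₐ[k] k) := by
  intro χ ψ h
  refine CharGroup.ext' fun a => ?_
  obtain ⟨a, rfl⟩ := Ideal.Quotient.mk_surjective a
  exact AlgHom.congr_fun h a

theorem char_algebraMap (χ : G₀ k C H) (c : C) :
    χ.char (algebraMap C H c) = Coalgebra.counit (R := k) c := by
  change χ.toAlgHom (Ideal.Quotient.mk _ (algebraMap C H c)) = _
  rw [mk_algebraMap_eq, AlgHom.commutes]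
  rfl

theorem exists_char_eq (χ : H →ₐ[k] k)
    (hχ : ∀ c : C, χ (algebraMap C H c) = Coalgebra.counit (R := k) c) :
    ∃ ψ : G₀ k C H, ψ.char = χ := by
  have hle : fiberIdeal H (augmentationIdeal k C) ≤ RingHom.ker χ := by
    refine Ideal.map_le_iff_le_comap.mpr fun c hc => ?_
    rw [Ideal.mem_comap, RingHom.mem_ker, hχ]
    exact hc
  exact ⟨WithConv.toConv (Ideal.Quotient.liftₐ _ χ fun a ha => hle ha), rfl⟩

open HopfAlgebra

theorem twist_one : twist (1 : G₀ k C H).char = AlgHom.id k H := by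
  ext h
  rw [twist_apply (Coalgebra.Repr.arbitrary k h)]
  exact Coalgebra.sum_counit_smul _

theorem twist_twist (χ ψ : G₀ k C H) (h : H) :
    twist χ.char (twist ψ.char h) = twist (ψ * χ).char h := by
  have h1 : scalarConv H (ψ * χ).char.toLinearMap =
      scalarConv H ψ.char.toLinearMap * scalarConv H χ.char.toLinearMap := by
    ext h
    rw [(Coalgebra.Repr.arbitrary k h).convMul_apply]
    change algebraMap k H ((ψ * χ).toAlgHom (Ideal.Quotient.mk _ h)) = _
    rw [CharGroup.mul_apply, Bialgebra.Quotient.comul_mk,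
      ← (Coalgebra.Repr.arbitrary k h).eq, map_sum, map_sum, map_sum, map_sum]
    refine Finset.sum_congr rfl fun i _ => ?_
    exact map_mul (algebraMap k H) _ _
  have h2 (χ : H →ₐ[k] k) :=
    toConv_comp_twist (AlgHom.id k H) χ
  have h3 : WithConv.toConv ((twist χ.char).toLinearMap ∘ₗ (twist ψ.char).toLinearMap) =
      WithConv.toConv ((AlgHom.id k H).toLinearMap ∘ₗ (twist (ψ * χ).char).toLinearMap) := by
    rw [toConv_comp_twist, h2, h1, mul_assoc, ← h2]
    rfl
  exact LinearMap.congr_fun (WithConv.toConv_injective h3) h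

theorem twist_inv_twist (χ : G₀ k C H) (h : H) : twist χ⁻¹.char (twist χ.char h) = h := by
  rw [twist_twist, mul_inv_cancel, twist_one]
  rfl

theorem twist_twist_inv (χ : G₀ k C H) (h : H) : twist χ.char (twist χ⁻¹.char h) = h := by
  rw [twist_twist, inv_mul_cancel, twist_one]
  rfl

theorem twist_algebraMap (χ : G₀ k C H) (c : C) :
    twist χ.char (algebraMap C H c) = algebraMap C H c := by
  let 𝓡 := Coalgebra.Repr.arbitrary k c
  let 𝓡' : Coalgebra.Repr k (algebraMap C H c) _ :=
    ⟨𝓡.index, _, _, comul_algebraMap_repr c⟩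
  rw [twist_apply 𝓡']
  have h := congrArg (algebraMap C H) (Coalgebra.sum_counit_smul 𝓡)
  refine Eq.trans ?_ h
  rw [map_sum]
  refine Finset.sum_congr rfl fun i _ => ?_
  refine (congrArg (· • _) (char_algebraMap χ _)).trans ?_
  rw [Algebra.smul_def (Coalgebra.counit (R := k) (𝓡.left i)) (𝓡.right i), map_mul,
    ← IsScalarTower.algebraMap_apply, Algebra.smul_def]

/-- The twist by `χ` fixes `C`, and so acts on every fiber. -/
def twistFiber (m : Ideal C) (χ : G₀ k C H) : Fiber H m →ₐ[k] Fiber H m :=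
  Ideal.Quotient.liftₐ (fiberIdeal H m)
    ((Ideal.Quotient.mkₐ k (fiberIdeal H m)).comp (twist χ.char)) (by
      have hle : fiberIdeal H m ≤
          RingHom.ker ((Ideal.Quotient.mkₐ k (fiberIdeal H m)).comp (twist χ.char)) := by
        refine Ideal.map_le_iff_le_comap.mpr fun c hc => ?_
        rw [Ideal.mem_comap, RingHom.mem_ker, AlgHom.comp_apply, twist_algebraMap]
        exact Ideal.Quotient.eq_zero_iff_mem.2 (Ideal.mem_map_of_mem _ hc)
      exact fun a ha => hle ha)

/-- The module `χ ⊗ V` is the restriction of `V` along the twist by `χ`. -/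
theorem lid_tensor_act (χ : G₀ k C H) (V : AlgModule.{u, v, w₁} k H) (h : H)
    (z : k ⊗[k] V) : TensorProduct.lid k V ((χ.toModule.tensor V).act h z) =
      V.act (twist χ.char h) (TensorProduct.lid k V z) := by
  have := AlgModule.isHom_tensor (M := χ.toModule) (N := V) (P := V.restrict (twist χ.char))
    (TensorProduct.lid k V).toLinearMap fun h a x => by
      change k at a
      change _ = V.act (twist χ.char h) (a • x)
      rw [twist_apply (Coalgebra.Repr.arbitrary k h), map_sum, LinearMap.sum_apply]
      refine Finset.sum_congr rfl fun i _ => ?_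
      change (χ.char _ * a) • V.act _ x = _
      rw [map_smul, map_smul, LinearMap.smul_apply, mul_smul, smul_comm]
  exact this h z

variable {m : Ideal C}

/-- The module `χ ⊗ V` of a fiber. -/
def twistModule (χ : G₀ k C H) (V : AlgModule.{u, v, w₁} k (Fiber H m)) :
    AlgModule.{u, v, w₁} k (Fiber H m) := V.restrict (twistFiber m χ)

theorem tensor_iso_twistModule (χ : G₀ k C H) (V : AlgModule.{u, v, w₁} k (Fiber H m)) :
    (χ.toModule.tensor V.inflate).Iso (χ.twistModule V).inflate :=
  ⟨TensorProduct.lid k V, fun h z => lid_tensor_act χ V.inflate h z⟩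

theorem isIrreducible_twistModule (χ : G₀ k C H) {V : AlgModule.{u, v, w₁} k (Fiber H m)}
    (hV : V.IsIrreducible) : (χ.twistModule V).IsIrreducible := by
  rw [AlgModule.isIrreducible_iff]
  refine ⟨hV.nontrivial, fun N hN => hV.eq_bot_or_eq_top fun a x hx => ?_⟩
  obtain ⟨h, rfl⟩ := Ideal.Quotient.mk_surjective a
  have := hN (Ideal.Quotient.mk _ (twist χ⁻¹.char h)) x hx
  change V.act (Ideal.Quotient.mk _ (twist χ.char (twist χ⁻¹.char h))) x ∈ N at this
  rwa [twist_twist_inv] at this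

variable (k H m) in
/-- The action `χ • [V] = [χ ⊗ V]` of `G₀` on the irreducible modules of a fiber. -/
abbrev mulActionIrr : MulAction (G₀ k C H) (Irr k (Fiber H m)) where
  smul χ := Quotient.map (fun V => ⟨χ.twistModule V.1, χ.isIrreducible_twistModule V.2⟩)
    fun V W h => by
      obtain ⟨e, he⟩ := h
      exact ⟨e, fun a x => he _ x⟩
  one_smul V := by
    induction V using Quotient.inductionOn with
    | h V =>
      refine Quotient.sound ⟨LinearEquiv.refl k V.1, fun a x => ?_⟩
      obtain ⟨h, rfl⟩ := Ideal.Quotient.mk_surjective a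
      change V.1.act (Ideal.Quotient.mk _ (twist (1 : G₀ k C H).char h)) x = _
      rw [twist_one]
      rfl
  mul_smul χ ψ V := by
    induction V using Quotient.inductionOn with
    | h V =>
      refine Quotient.sound ⟨LinearEquiv.refl k V.1, fun a x => ?_⟩
      obtain ⟨h, rfl⟩ := Ideal.Quotient.mk_surjective a
      change V.1.act (Ideal.Quotient.mk _ (twist (χ * ψ).char h)) x =
        V.1.act (Ideal.Quotient.mk _ (twist ψ.char (twist χ.char h))) x
      rw [twist_twist]

theorem smul_cls_eq_iff (χ : G₀ k C H) (V W : IrrModule k (Fiber H m)) :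
    (mulActionIrr k H m).smul χ V.cls = W.cls ↔
      (χ.toModule.tensor V.1.inflate).Iso W.1.inflate := by
  have h1 : (mulActionIrr k H m).smul χ V.cls = W.cls ↔ (χ.twistModule V.1).Iso W.1 :=
    Quotient.eq
  rw [h1, ← AlgModule.inflate_iso_iff]
  have h2 := χ.tensor_iso_twistModule V.1
  exact ⟨fun h => h2.trans h, fun h => h2.symm.trans h⟩

end G₀

/-! ### One-dimensional modules -/

namespace AlgModule

section OneDimensional

variable {k : Type u} {A : Type v} [Field k] [Ring A] [Algebra k A]

/-- A one-dimensional module is given by a character. -/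
theorem exists_character_of_finrank_eq_one (M : AlgModule.{u, v, w} k A)
    (hM : Module.finrank k M = 1) : ∃ χ : A →ₐ[k] k, ∀ a x, M.act a x = χ a • x := by
  obtain ⟨x₀, h0, hx₀⟩ := finrank_eq_one_iff'.1 hM
  have hb : Function.Bijective (Algebra.ofId k (Module.End k M)) := by
    have : Nontrivial M := ⟨x₀, 0, h0⟩
    refine ⟨(algebraMap k (Module.End k M)).injective, fun f => ?_⟩
    obtain ⟨c, hc⟩ := hx₀ (f x₀)
    refine ⟨c, LinearMap.ext fun y => ?_⟩
    obtain ⟨d, rfl⟩ := hx₀ y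
    rw [map_smul, map_smul, ← hc]
    rfl
  let e := AlgEquiv.ofBijective _ hb
  refine ⟨e.symm.toAlgHom.comp M.act, fun a x => ?_⟩
  have h : e (e.symm (M.act a)) = M.act a := e.apply_symm_apply _
  conv_lhs => rw [← h]
  rfl

theorem ofCharacter_iso {M : AlgModule.{u, v, w} k A} (hM : Module.finrank k M = 1)
    {χ : A →ₐ[k] k} (hχ : ∀ a x, M.act a x = χ a • x) : (ofCharacter χ).Iso M := by
  have := Module.finite_of_finrank_eq_succ hM
  let e : k ≃ₗ[k] M := LinearEquiv.ofFinrankEq k M (by rw [hM, Module.finrank_self])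
  refine ⟨e, fun a x => ?_⟩
  change k at x
  change e (χ a * x) = M.act a (e x)
  rw [hχ, ← map_smul, smul_eq_mul]

theorem ofCharacter_iso_iff {χ ψ : A →ₐ[k] k} :
    (ofCharacter χ).Iso (ofCharacter ψ) ↔ χ = ψ := by
  constructor
  · rintro ⟨e, he⟩
    change k ≃ₗ[k] k at e
    ext a
    have h1 : e (χ a * 1) = ψ a * e 1 := he a (1 : k)
    rw [mul_one, ← mul_one (χ a), ← smul_eq_mul, map_smul, smul_eq_mul] at h1
    have h2 : e 1 ≠ 0 := fun h => one_ne_zero (e.injective (h.trans (map_zero e).symm))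
    exact mul_right_cancel₀ h2 h1
  · rintro rfl
    exact Iso.refl _

theorem isIrreducible_ofCharacter (χ : A →ₐ[k] k) : (ofCharacter χ).IsIrreducible := by
  refine (isIrreducible_iff _).2 ⟨inferInstanceAs (Nontrivial k), fun N _ => ?_⟩
  exact eq_bot_or_eq_top (α := Submodule k k) N

/-- Over a basic algebra the commutators act by zero on an irreducible module, so that every
element acts by a scalar and the module is one-dimensional. -/
theorem IsIrreducible.exists_ofCharacter_iso [IsAlgClosed k] (hA : IsBasicAlgebra k A)
    {M : AlgModule.{u, v, w} k A} (hM : M.IsIrreducible) :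
    ∃ χ : A →ₐ[k] k, (ofCharacter χ).Iso M := by
  obtain ⟨hfin, n, ⟨e⟩⟩ := hA
  have hMf := hM.finite
  have hMn := hM.nontrivial
  have hJ (a : A) (ha : a ∈ Ring.jacobson A) : M.act a = 0 := by
    let : Module A M := Module.compHom M M.act.toRingHom
    have hs : IsSimpleModule A M := hM
    have h := IsSemisimpleModule.jacobson_le_annihilator A M ha
    exact LinearMap.ext fun x => Module.mem_annihilator.1 h x
  have hcomm (a b : A) : M.act a * M.act b = M.act b * M.act a := by
    rw [← sub_eq_zero, ← map_mul, ← map_mul, ← map_sub]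
    apply hJ
    rw [← Ideal.Quotient.eq_zero_iff_mem, map_sub, map_mul, map_mul, sub_eq_zero]
    apply e.injective
    rw [map_mul, map_mul, mul_comm]
  have hscal (a : A) : ∃ r : k, ∀ x, M.act a x = r • x :=
    hM.exists_smul_eq fun b x => LinearMap.congr_fun (hcomm a b) x
  obtain ⟨x₀, h0⟩ := exists_ne (0 : M)
  have hst : M.IsStable (k ∙ x₀) := fun a x hx => by
    obtain ⟨r, hr⟩ := hscal a
    rw [hr]
    exact Submodule.smul_mem _ _ hx
  have htop : (k ∙ x₀) = ⊤ := (hM.eq_bot_or_eq_top hst).resolve_left fun h =>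
    h0 (Submodule.span_singleton_eq_bot.1 h)
  have h1 : Module.finrank k M = 1 := finrank_eq_one_iff'.2 ⟨x₀, h0, fun y =>
    Submodule.mem_span_singleton.1 (htop ▸ Submodule.mem_top)⟩
  obtain ⟨χ, hχ⟩ := M.exists_character_of_finrank_eq_one h1
  exact ⟨χ, ofCharacter_iso h1 hχ⟩

/-- A module, with its underlying vector space moved to a larger universe. -/
def lift (M : AlgModule.{u, v, w} k A) : AlgModule.{u, v, max w w₁} k A where
  carrier := ULift.{w₁} M
  act := ((ULift.moduleEquiv (R := k) (M := M)).symm.conjAlgEquiv k).toAlgHom.comp M.act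

theorem lift_iso (M : AlgModule.{u, v, w} k A) : (lift.{u, v, w, w₁} M).Iso M :=
  ⟨ULift.moduleEquiv, fun _ _ => rfl⟩

/-- A nonzero finite dimensional algebra has an irreducible module. -/
theorem nonempty_irr [Module.Finite k A] [Nontrivial A] : Nonempty (Irr k A) := by
  let M : AlgModule.{u, v, v} k A := { carrier := A, act := Algebra.lmul k A }
  have h1 : Module.Finite k M := inferInstanceAs (Module.Finite k A)
  have h2 : Nontrivial M := inferInstanceAs (Nontrivial A)
  obtain ⟨N, hN, hirr⟩ := M.exists_irreducible_sub
  exact ⟨IrrModule.cls ⟨lift.{u, v, v, u} (M.sub N hN), (lift_iso _).symm.isIrreducible hirr⟩⟩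

end OneDimensional

/-! ### Stabilizers -/

section Stabilizers

variable {k : Type u} {C : Type w} {H : Type v} [Field k] [CommRing C] [HopfAlgebra k C]
  [Ring H] [HopfAlgebra k H] [Algebra C H] [IsScalarTower k C H] [IsCentralHopfSubalgebra k C H]
  {V : AlgModule.{u, v, w₁} k H} {S : Subgroup (G₀ k C H)}

/-- The endomorphism `T` has weight `χ` for the adjoint action. -/
def HasWeight (V : AlgModule.{u, v, w₁} k H) (χ : H →ₐ[k] k) (T : V →ₗ[k] V) : Prop :=
  ∀ h x, V.act h (T x) = T (V.act (HopfAlgebra.twist χ h) x)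

theorem HasWeight.isHom {χ : G₀ k C H} {T : V →ₗ[k] V} (hT : V.HasWeight χ.char T) :
    IsHom (M := χ.toModule.tensor V) (N := V) (T ∘ₗ (TensorProduct.lid k V).toLinearMap) := by
  intro h z
  change T (TensorProduct.lid k V _) = V.act h (T (TensorProduct.lid k V z))
  rw [hT]
  exact congrArg T (G₀.lid_tensor_act χ V h z)

theorem exists_hasWeight {χ : G₀ k C H} (h : (χ.toModule.tensor V).Iso V) :
    ∃ e : V ≃ₗ[k] V, V.HasWeight χ.char e.toLinearMap := by
  obtain ⟨e, he⟩ := h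
  change k ⊗[k] V ≃ₗ[k] V at e
  refine ⟨(TensorProduct.lid k V).symm.trans e, fun h x => ?_⟩
  change V.act h (e ((TensorProduct.lid k V).symm x)) = e ((TensorProduct.lid k V).symm _)
  refine (he h ((TensorProduct.lid k V).symm x)).symm.trans (congrArg e ?_)
  apply (TensorProduct.lid k V).injective
  refine (G₀.lid_tensor_act χ V h _).trans ?_
  rw [LinearEquiv.apply_symm_apply, LinearEquiv.apply_symm_apply]

/-- A nonzero endomorphism of weight `χ` is an isomorphism from `χ ⊗ V` to `V`. -/
theorem HasWeight.iso (hV : V.IsIrreducible) {χ : G₀ k C H}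
    (hχV : (χ.toModule.tensor V).IsIrreducible) {T : V →ₗ[k] V} (hT : V.HasWeight χ.char T)
    (h0 : T ≠ 0) : (χ.toModule.tensor V).Iso V := by
  have h : T ∘ₗ (TensorProduct.lid k V).toLinearMap ≠ 0 := by
    intro h
    apply h0
    refine LinearMap.ext fun x => ?_
    have := LinearMap.congr_fun h ((TensorProduct.lid k V).symm x)
    simpa using this
  exact hT.isHom.iso ⟨hT.isHom.injective hχV h, hT.isHom.surjective hV h⟩

theorem HasWeight.act_homMod {χ : H →ₐ[k] k} {T : V →ₗ[k] V} (hT : V.HasWeight χ T) (h : H) :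
    (V.homMod V).act h T = (χ h • T : V →ₗ[k] V) :=
  (homMod_weight_iff V χ T).2 hT h

/-- Nonzero endomorphisms whose weights are distinct elements of `G₀` are linearly independent. -/
theorem linearIndependent_of_hasWeight {T : S → (V →ₗ[k] V)}
    (hT : ∀ χ : S, V.HasWeight (χ : G₀ k C H).char (T χ)) (h0 : ∀ χ, T χ ≠ 0) :
    LinearIndependent k T :=
  linearIndependent_of_weights (V.homMod V) (χ := fun χ : S => (χ : G₀ k C H).char)
    (fun _ _ h => Subtype.ext (G₀.char_injective h)) h0 fun χ h => (hT χ).act_homMod h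

variable (S V) in
/-- The subgroup `S` of `G₀` is the stabilizer of `V`. -/
def IsStabilizer : Prop := ∀ χ : G₀ k C H, χ ∈ S ↔ (χ.toModule.tensor V).Iso V

theorem IsStabilizer.exists_family (hS : V.IsStabilizer S) :
    ∃ T : S → (V ≃ₗ[k] V), ∀ χ : S, V.HasWeight (χ : G₀ k C H).char (T χ).toLinearMap :=
  Classical.axiom_of_choice fun χ : S => exists_hasWeight ((hS χ).1 χ.2)

theorem equiv_ne_zero [Nontrivial V] (e : V ≃ₗ[k] V) : e.toLinearMap ≠ 0 := by
  obtain ⟨x, hx⟩ := exists_ne (0 : V)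
  intro h
  exact hx (e.injective ((LinearMap.congr_fun h x).trans (map_zero e).symm))

variable [Module.Finite k V]

theorem IsStabilizer.finite [Nontrivial V] (hS : V.IsStabilizer S) : Finite S := by
  obtain ⟨T, hT⟩ := hS.exists_family
  exact (linearIndependent_of_hasWeight hT fun χ => equiv_ne_zero (T χ)).finite

theorem IsStabilizer.card_le [Nontrivial V] (hS : V.IsStabilizer S) : Nat.card S ≤ V.dim ^ 2 := by
  obtain ⟨T, hT⟩ := hS.exists_family
  have := hS.finite
  have := Fintype.ofFinite S
  have h := (linearIndependent_of_hasWeight hT fun χ => equiv_ne_zero (T χ)).fintype_card_le_finrank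
  rwa [Module.finrank_linearMap, ← Nat.card_eq_fintype_card, ← sq] at h

theorem IsStabilizer.encard_eq [Nontrivial V] (hS : V.IsStabilizer S) :
    (S : Set (G₀ k C H)).encard = (Nat.card S : ℕ∞) := by
  have : Finite (S : Set (G₀ k C H)) := hS.finite
  rw [← Set.Finite.cast_ncard_eq (Set.toFinite _)]
  rfl

theorem IsStabilizer.encard_eq_iff [Nontrivial V] (hS : V.IsStabilizer S) :
    (S : Set (G₀ k C H)).encard = (V.dim : ℕ∞) ^ 2 ↔ Nat.card S = V.dim ^ 2 := by
  rw [hS.encard_eq]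
  exact_mod_cast Iff.rfl

/-- For a maximally stable module, the endomorphisms with weights in the stabilizer form a basis. -/
theorem IsStabilizer.exists_basis [Nontrivial V] (hS : V.IsStabilizer S)
    (hc : Nat.card S = V.dim ^ 2) {T : S → (V →ₗ[k] V)}
    (hT : ∀ χ : S, V.HasWeight (χ : G₀ k C H).char (T χ)) (h0 : ∀ χ, T χ ≠ 0) :
    ∃ b : Module.Basis S k (V →ₗ[k] V), ∀ χ, b χ = T χ := by
  have := hS.finite
  have := Fintype.ofFinite S
  let b := basisOfLinearIndependentOfCardEqFinrank (linearIndependent_of_hasWeight hT h0) (by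
    rw [Module.finrank_linearMap, ← Nat.card_eq_fintype_card, ← sq]
    exact hc)
  exact ⟨b, fun χ => by simp [b]⟩

/-- The decomposition of `V ⊗ V* ≅ End(V)` for a maximally stable module. -/
theorem IsStabilizer.tensor_dual_iso [Nontrivial V] (hS : V.IsStabilizer S)
    (hc : Nat.card S = V.dim ^ 2) :
    (V.tensor V.dual).Iso (directSum fun χ : S => G₀.toModule (χ : G₀ k C H)) := by
  classical
  obtain ⟨T, hT⟩ := hS.exists_family
  obtain ⟨b, hb⟩ := hS.exists_basis hc hT fun χ => equiv_ne_zero (T χ)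
  refine (V.tensor_dual_iso V).trans (Iso.symm ?_)
  let e : (DirectSum S fun _ => k) ≃ₗ[k] (V →ₗ[k] V) :=
    (finsuppLEquivDirectSum k k S).symm.trans b.repr.symm
  have he (χ : S) (a : k) : e (DirectSum.lof k S (fun _ => k) χ a) = a • (T χ).toLinearMap := by
    change b.repr.symm ((finsuppLEquivDirectSum k k S).symm _) = _
    rw [finsuppLEquivDirectSum_symm_lof, b.repr_symm_single, hb]
  refine ⟨e, fun h x => ?_⟩
  let D := directSum fun χ : S => G₀.toModule (χ : G₀ k C H)
  have hh : e.toLinearMap ∘ₗ (D.act h : (DirectSum S fun _ => k) →ₗ[k] _) =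
      ((V.homMod V).act h : (V →ₗ[k] V) →ₗ[k] _) ∘ₗ e.toLinearMap := by
    refine DirectSum.linearMap_ext k fun χ => LinearMap.ext_ring ?_
    change e (DirectSum.lmap _ (DirectSum.lof k S (fun _ => k) χ 1)) =
      (V.homMod V).act h (e (DirectSum.lof k S (fun _ => k) χ 1))
    rw [he, one_smul, (hT χ).act_homMod]
    refine (congrArg e (DirectSum.lmap_lof (R := k)
      (fun i : S => (G₀.toModule (i : G₀ k C H)).act h) χ (1 : k))).trans ((he χ _).trans ?_)
    change ((χ : G₀ k C H).char h * 1) • _ = _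
    rw [mul_one]
  exact LinearMap.congr_fun hh x

/-- If `V ⊗ V*` is a sum of pairwise nonisomorphic one-dimensional modules, then each of the
`dim(V)²` summands is given by an element of the stabilizer of `V`. -/
theorem IsStabilizer.card_eq [Nontrivial V] (hS : V.IsStabilizer S) (hV : V.IsIrreducible)
    (hχV : ∀ χ : G₀ k C H, (χ.toModule.tensor V).IsIrreducible) {φ : C →ₐ[k] k}
    (hφ : V.HasCentralCharacter φ) {ι : Type w₂} (N : ι → AlgModule.{u, v, w₃} k H)
    (hN : ∀ i, (N i).dim = 1) (hne : ∀ i j, i ≠ j → ¬ (N i).Iso (N j))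
    (h : (V.tensor V.dual).Iso (directSum N)) : Nat.card S = V.dim ^ 2 := by
  classical
  choose ψ hψ using fun i => (N i).exists_character_of_finrank_eq_one (hN i)
  have hψi : Function.Injective ψ := by
    intro i j hij
    by_contra hne'
    refine hne i j hne' ((ofCharacter_iso (hN i) (hψ i)).symm.trans ?_)
    rw [hij]
    exact ofCharacter_iso (hN j) (hψ j)
  obtain ⟨e, he⟩ := h.symm.trans (V.tensor_dual_iso V)
  change (DirectSum ι fun i => N i) ≃ₗ[k] (V →ₗ[k] V) at e
  have hNn (i : ι) : Nontrivial (N i) :=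
    Module.nontrivial_of_finrank_pos (R := k)
      (zero_lt_one.trans_eq (hN i).symm)
  choose x hx using fun i => exists_ne (0 : N i)
  let T (i : ι) : V →ₗ[k] V := e (DirectSum.lof k ι (fun i => N i) i (x i))
  have hT0 (i : ι) : T i ≠ 0 := by
    intro h0
    have h1 := e.injective (h0.trans (map_zero e).symm)
    refine hx i (DirectSum.of_injective i (h1.trans (map_zero _).symm))
  have hTψ (i : ι) (a : H) : (V.homMod V).act a (T i) = (ψ i a • T i : V →ₗ[k] V) := by
    refine (he a (DirectSum.lof k ι (fun i => N i) i (x i))).symm.trans ?_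
    change e (DirectSum.lmap _ (DirectSum.lof k ι (fun i => N i) i (x i))) = _
    rw [DirectSum.lmap_lof, hψ, map_smul, map_smul]
  have hψC (i : ι) (c : C) : ψ i (algebraMap C H c) = Coalgebra.counit (R := k) c := by
    have h1 := hTψ i (algebraMap C H c)
    have h2 : (V.homMod V).act (algebraMap C H c) (T i) =
        (Coalgebra.counit (R := k) c • T i : V →ₗ[k] V) := by
      rw [hφ.homMod hφ c]
      rfl
    exact (smul_left_injective k (hT0 i) (h2.symm.trans h1)).symm
  choose χ hχ using fun i => G₀.exists_char_eq (C := C) (ψ i) (hψC i)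
  have hχS (i : ι) : χ i ∈ S := by
    refine (hS (χ i)).2 (HasWeight.iso hV (hχV (χ i)) ?_ (hT0 i))
    rw [hχ]
    exact (homMod_weight_iff V (ψ i) (T i)).1 (hTψ i)
  have hinj : Function.Injective fun i => (⟨χ i, hχS i⟩ : S) := by
    intro i j hij
    apply hψi
    rw [← hχ, ← hχ, Subtype.mk.inj hij]
  have := hS.finite
  have : Finite ι := Finite.of_injective _ hinj
  have := Fintype.ofFinite ι
  have hNf (i : ι) : Module.Finite k (N i) := Module.finite_of_finrank_eq_succ (hN i)
  have hι : Nat.card ι = V.dim ^ 2 := by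
    have h1 := e.finrank_eq
    rw [Module.finrank_directSum, Module.finrank_linearMap,
      Finset.sum_congr rfl fun i _ => show Module.finrank k (N i) = 1 from hN i] at h1
    rw [Nat.card_eq_fintype_card, sq]
    simpa [dim] using h1
  refine le_antisymm hS.card_le ?_
  rw [← hι]
  exact Nat.card_le_card_of_injective _ hinj

end Stabilizers

end AlgModule

/-! ### The cocycle of a module and its twisted group algebra -/

namespace AlgModule

section Cocycle

variable {k : Type u} {C : Type w} {H : Type v} [Field k] [CommRing C] [HopfAlgebra k C]
  [Ring H] [HopfAlgebra k H] [Algebra C H] [IsScalarTower k C H] [IsCentralHopfSubalgebra k C H]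
  {V : AlgModule.{u, v, w₁} k H} {S : Subgroup (G₀ k C H)}

/-- An isomorphism `V ≅ χ⁻¹ ⊗ V` is an automorphism of the vector space `V` of weight `χ`. -/
theorem isTwistedIsoFamily_iff {L : S → (V ≃ₗ[k] V)} :
    IsTwistedIsoFamily S V L ↔
      ∀ χ : S, V.HasWeight (χ : G₀ k C H).char (L χ).toLinearMap := by
  have h1 (χ : S) (h : H) (x : V) :
      ((TensorProduct.lid k V).symm (L χ (V.act h x)) =
        (((χ : G₀ k C H)⁻¹).toModule.tensor V).act h ((TensorProduct.lid k V).symm (L χ x))) ↔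
      L χ (V.act h x) = V.act (HopfAlgebra.twist ((χ : G₀ k C H)⁻¹).char h) (L χ x) := by
    have h2 := G₀.lid_tensor_act ((χ : G₀ k C H)⁻¹) V h ((TensorProduct.lid k V).symm (L χ x))
    rw [LinearEquiv.apply_symm_apply] at h2
    rw [← h2]
    exact LinearEquiv.symm_apply_eq _
  refine forall_congr' fun χ => ⟨fun h a x => ?_, fun h a x => ?_⟩
  · have h2 := (h1 χ (HopfAlgebra.twist (χ : G₀ k C H).char a) x).1 (h _ x)
    rw [G₀.twist_inv_twist] at h2
    exact h2.symm
  · refine (h1 χ a x).2 ?_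
    have h2 := h (HopfAlgebra.twist ((χ : G₀ k C H)⁻¹).char a) x
    rw [G₀.twist_twist_inv] at h2
    exact h2.symm

theorem HasWeight.mul {χ ψ : G₀ k C H} {T U : V →ₗ[k] V} (hT : V.HasWeight χ.char T)
    (hU : V.HasWeight ψ.char U) : V.HasWeight (χ * ψ).char (T ∘ₗ U) := by
  intro h x
  rw [LinearMap.comp_apply, LinearMap.comp_apply, hT, hU, G₀.twist_twist]

variable [Module.Finite k V]

/-- The twisted group algebra of a maximally stable module is the endomorphism algebra. -/
theorem IsStabilizer.nonempty_twistedGroupAlgebra_algEquiv (hS : V.IsStabilizer S) [Nontrivial V]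
    (hc : Nat.card S = V.dim ^ 2) {L : S → (V ≃ₗ[k] V)}
    (hL : ∀ χ : S, V.HasWeight (χ : G₀ k C H).char (L χ).toLinearMap) {γ : TwoCocycle S k}
    (hγ : ∀ χ θ x, L χ (L θ x) = (γ.toFun χ θ : k) • L (χ * θ) x) :
    Nonempty (TwistedGroupAlgebra γ ≃ₐ[k] Module.End k V) := by
  obtain ⟨b, hb⟩ := hS.exists_basis hc hL fun χ => equiv_ne_zero (L χ)
  let e : TwistedGroupAlgebra γ ≃ₗ[k] Module.End k V := b.repr.symm
  have he (χ : S) (a : k) : e (TwistedGroupAlgebra.single χ a) = a • (L χ).toLinearMap := by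
    change b.repr.symm (Finsupp.single χ a) = _
    rw [b.repr_symm_single, hb]
  have hmul (x y : TwistedGroupAlgebra γ) : e (x * y) = e x * e y := by
    refine TwistedGroupAlgebra.induction_on' (p := fun x => e (x * y) = e x * e y) x
      (by rw [zero_mul, map_zero, zero_mul]) (fun χ r => ?_)
      (fun x x' hx hx' => by rw [add_mul, map_add, map_add, add_mul, hx, hx'])
    refine TwistedGroupAlgebra.induction_on'
      (p := fun y => e (TwistedGroupAlgebra.single χ r * y) =
        e (TwistedGroupAlgebra.single χ r) * e y) y
      (by rw [mul_zero, map_zero, mul_zero]) (fun θ s => ?_)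
      (fun y y' hy hy' => by rw [mul_add, map_add, map_add, mul_add, hy, hy'])
    rw [TwistedGroupAlgebra.single_mul_single, he, he, he, smul_mul_smul_comm, mul_comm,
      mul_smul]
    congr 1
    refine LinearMap.ext fun z => ?_
    exact (hγ χ θ z).symm
  have hone : e 1 = 1 := by
    obtain ⟨z, hz⟩ := e.surjective 1
    have := hmul z 1
    rw [mul_one, hz, one_mul] at this
    exact this.symm
  exact ⟨AlgEquiv.ofLinearEquiv e hone hmul⟩

variable [IsAlgClosed k]

/-- Two automorphisms of the same weight are proportional, by Schur's lemma. -/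
theorem HasWeight.exists_unit_smul (hV : V.IsIrreducible) {χ : G₀ k C H} {e f : V ≃ₗ[k] V}
    (he : V.HasWeight χ.char e.toLinearMap) (hf : V.HasWeight χ.char f.toLinearMap) :
    ∃ r : kˣ, ∀ x, e x = (r : k) • f x := by
  have := hV.nontrivial
  have hhom : IsHom (M := V) (N := V) (e.trans f.symm).toLinearMap := by
    intro h x
    change f.symm (e (V.act h x)) = V.act h (f.symm (e x))
    apply f.injective
    have h1 := he (HopfAlgebra.twist χ⁻¹.char h) x
    have h2 := hf (HopfAlgebra.twist χ⁻¹.char h) (f.symm (e x))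
    rw [G₀.twist_twist_inv] at h1 h2
    rw [LinearEquiv.apply_symm_apply]
    refine h1.symm.trans (Eq.trans ?_ h2)
    exact congrArg _ (f.apply_symm_apply (e x)).symm
  obtain ⟨r, hr⟩ := hV.exists_smul_eq hhom
  have hr' (x : V) : e x = r • f x := by
    rw [← map_smul]
    refine Eq.trans ?_ (congrArg f (hr x))
    exact (f.apply_symm_apply (e x)).symm
  have h0 : r ≠ 0 := by
    rintro rfl
    obtain ⟨x, hx⟩ := exists_ne (0 : V)
    exact hx (e.injective (by rw [hr', zero_smul, map_zero]))
  exact ⟨Units.mk0 r h0, hr'⟩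

/-- The product of the `L χ` defines a unique cocycle; it is a cocycle by associativity. -/
theorem existsUnique_cocycle (hV : V.IsIrreducible) {L : S → (V ≃ₗ[k] V)}
    (hL : ∀ χ : S, V.HasWeight (χ : G₀ k C H).char (L χ).toLinearMap) :
    ∃ γ : TwoCocycle S k, (∀ χ θ x, L χ (L θ x) = (γ.toFun χ θ : k) • L (χ * θ) x) ∧
      ∀ γ' : TwoCocycle S k, (∀ χ θ x, L χ (L θ x) = (γ'.toFun χ θ : k) • L (χ * θ) x) →
        γ' = γ := by
  have := hV.nontrivial
  have h1 (χ θ : S) : ∃ r : kˣ, ∀ x, L χ (L θ x) = (r : k) • L (χ * θ) x :=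
    HasWeight.exists_unit_smul hV (e := (L θ).trans (L χ)) ((hL χ).mul (hL θ)) (hL (χ * θ))
  choose g hg using h1
  have hcancel {r s : kˣ} (χ : S) (h : ∀ x, (r : k) • L χ x = (s : k) • L χ x) : r = s := by
    obtain ⟨x, hx⟩ := exists_ne (0 : V)
    have hx' : L χ x ≠ 0 := fun h0 => hx ((L χ).injective (h0.trans (map_zero _).symm))
    exact Units.ext (smul_left_injective k hx' (h x))
  refine ⟨⟨g, fun a b c => hcancel (a * b * c) fun x => ?_⟩, hg, fun γ' hγ' => ?_⟩
  · have h2 : L a (L b (L c x)) = ((g a b * g (a * b) c : kˣ) : k) • L (a * b * c) x := by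
      rw [hg, hg, smul_smul, Units.val_mul]
    have h3 : L a (L b (L c x)) = ((g b c * g a (b * c) : kˣ) : k) • L (a * b * c) x := by
      rw [hg b c, map_smul, hg, smul_smul, Units.val_mul, mul_assoc a]
    rw [← h2, h3]
  · obtain ⟨g', hc'⟩ := γ'
    have : g' = g := by
      funext a b
      exact hcancel (a * b) fun x => by rw [← hg, hγ']
    subst this
    rfl

theorem IsIrreducible.nonempty_quotient_annihilator_algEquiv (hV : V.IsIrreducible) :
    Nonempty ((H ⧸ V.annihilator) ≃ₐ[k] Module.End k V) :=
  ⟨Ideal.quotientKerAlgEquivOfSurjective hV.act_surjective⟩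

end Cocycle

end AlgModule

/-! ### The embedding of the characters and the transitivity of their action -/

section Characters

open AlgModule

variable {k : Type u} {A : Type v} [Field k] [Ring A] [HopfAlgebra k A]

/-- The irreducible module given by a character. -/
def CharGroup.irrModule (χ : CharGroup k A) : IrrModule k A :=
  ⟨lift.{u, v, u, v} (ofCharacter χ.toAlgHom),
    (lift_iso _).symm.isIrreducible (isIrreducible_ofCharacter _)⟩

theorem CharGroup.cls_irrModule_eq_iff (χ : CharGroup k A) (M : IrrModule k A) :
    χ.irrModule.cls = M.cls ↔ (ofCharacter χ.toAlgHom).Iso M.1 := by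
  have h1 : χ.irrModule.cls = M.cls ↔ χ.irrModule.1.Iso M.1 := Quotient.eq
  rw [h1]
  have h2 : χ.irrModule.1.Iso (ofCharacter χ.toAlgHom) := lift_iso _
  exact ⟨fun h => h2.symm.trans h, fun h => h2.trans h⟩

theorem CharGroup.cls_irrModule_injective :
    Function.Injective fun χ : CharGroup k A => χ.irrModule.cls := by
  intro χ ψ h
  have h1 := (χ.cls_irrModule_eq_iff ψ.irrModule).1 h
  have h2 : χ.toAlgHom = ψ.toAlgHom := ofCharacter_iso_iff.1 (h1.trans (lift_iso _))
  exact CharGroup.ext' fun a => AlgHom.congr_fun h2 a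

end Characters

section Transitivity

open AlgModule

variable {k : Type u} {C : Type w} {H : Type v} [Field k] [IsAlgClosed k]
  [CommRing C] [HopfAlgebra k C] [Ring H] [HopfAlgebra k H] [Algebra C H] [IsScalarTower k C H]
  [IsCentralHopfSubalgebra k C H]

/-- If the identity fiber is basic, then `W` is a quotient of `χ ⊗ V` for a character `χ`, and
isomorphic to it, because `χ ⊗ V` is irreducible. -/
theorem exists_tensor_iso_of_isBasicAlgebra {m : Ideal C} {φ : C →ₐ[k] k}
    (hφ : RingHom.ker φ = m) [Module.Finite k (Fiber H m)]
    (hb : IsBasicAlgebra k (IdentityFiber k C H)) (V W : IrrModule k (Fiber H m)) :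
    ∃ χ : G₀ k C H, (χ.toModule.tensor V.1.inflate).Iso W.1.inflate := by
  obtain ⟨M, f, hf, hsurj⟩ := exists_isQuotientOf hφ V W
  obtain ⟨χ, e, he⟩ := M.2.exists_ofCharacter_iso hb
  let ψ : G₀ k C H := WithConv.toConv χ
  refine ⟨ψ, ?_⟩
  change k ≃ₗ[k] M.1 at e
  have he' : IsHom (M := ψ.toModule) (N := M.1.inflate) e.toLinearMap := fun a x => he _ x
  have hr := he'.rTensor V.1.inflate
  let g : k ⊗[k] V.1 →ₗ[k] W.1 := f ∘ₗ LinearMap.rTensor V.1 e.toLinearMap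
  have hg : IsHom (M := ψ.toModule.tensor V.1.inflate) (N := W.1.inflate) g := fun a x =>
    (congrArg f (hr a x)).trans (hf a _)
  have hgs : Function.Surjective g :=
    hsurj.comp (LinearMap.rTensor_surjective V.1 e.surjective)
  have hψV : (ψ.toModule.tensor V.1.inflate).IsIrreducible :=
    (ψ.tensor_iso_twistModule V.1).symm.isIrreducible
      ((isIrreducible_inflate_iff _).2 (ψ.isIrreducible_twistModule V.2))
  have hWn : Nontrivial W.1 := W.2.nontrivial
  have hg0 : g ≠ 0 := by
    intro h0
    obtain ⟨x, hx⟩ := exists_ne (0 : W.1)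
    obtain ⟨z, hz⟩ := hgs x
    exact hx (by rw [← hz, h0, LinearMap.zero_apply])
  exact hg.iso ⟨hg.injective hψV hg0, hgs⟩

end Transitivity

end

theorem theoremA {k : Type u} {C : Type w} {H : Type v} [Field k] [IsAlgClosed k]
    [CommRing C] [HopfAlgebra k C] [Ring H] [HopfAlgebra k H]
    [Algebra C H] [IsScalarTower k C H] [IsCentralHopfSubalgebra k C H]
    [Algebra.FiniteType k H] [Module.Finite C H]
    (m : Ideal C) [m.IsMaximal] :
    -- (a)
    (∀ V W : IrrModule k (Fiber H m),
      (∃ M' : IrrModule k (IdentityFiber k C H),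
        W.1.inflate.IsQuotientOf (M'.1.inflate.tensor V.1.inflate)) ∧
      (∃ M'' : IrrModule k (IdentityFiber k C H),
        W.1.inflate.IsSubmoduleOf (M''.1.inflate.tensor V.1.inflate))) ∧
    -- (b), the inclusion `ι` of `G₀` and the action of `G₀`
    ∃ (ι : G₀ k C H → Irr k (IdentityFiber k C H))
      (_ : MulAction (G₀ k C H) (Irr k (Fiber H m))),
      (Function.Injective ι ∧
        ∀ (χ : G₀ k C H) (M : IrrModule k (IdentityFiber k C H)),
          ι χ = M.cls ↔ (AlgModule.ofCharacter χ.toAlgHom).Iso M.1) ∧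
      (∀ (χ : G₀ k C H) (V W : IrrModule k (Fiber H m)),
        χ • V.cls = W.cls ↔ (χ.toModule.tensor V.1.inflate).Iso W.1.inflate) ∧
      (∀ V : IrrModule k (Fiber H m),
        -- (c)
        (MulAction.stabilizer (G₀ k C H) V.cls : Set (G₀ k C H)).encard ≤ (V.1.dim : ℕ∞) ^ 2 ∧
        -- (d), (i) if and only if (ii)
        ((MulAction.stabilizer (G₀ k C H) V.cls : Set (G₀ k C H)).encard = (V.1.dim : ℕ∞) ^ 2 ↔
          ∃ (T : Type (max u v)) (N : T → AlgModule.{u, v, u} k H),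
            (∀ i, (N i).dim = 1) ∧ (∀ i j, i ≠ j → ¬ (N i).Iso (N j)) ∧
            (V.1.inflate.tensor V.1.inflate.dual).Iso (AlgModule.directSum N)) ∧
        -- (d), (i) if and only if (iii)
        ((MulAction.stabilizer (G₀ k C H) V.cls : Set (G₀ k C H)).encard = (V.1.dim : ℕ∞) ^ 2 ↔
          (V.1.inflate.tensor V.1.inflate.dual).Iso
            (AlgModule.directSum fun χ : MulAction.stabilizer (G₀ k C H) V.cls =>
              G₀.toModule (χ : G₀ k C H))) ∧
        -- (e), the cocycle `γ` and the isomorphisms for a maximally stable module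
        (∃ L : MulAction.stabilizer (G₀ k C H) V.cls → (V.1.inflate ≃ₗ[k] V.1.inflate),
          IsTwistedIsoFamily _ V.1.inflate L) ∧
        (∀ L : MulAction.stabilizer (G₀ k C H) V.cls → (V.1.inflate ≃ₗ[k] V.1.inflate),
          IsTwistedIsoFamily _ V.1.inflate L →
          ∃ γ : TwoCocycle (MulAction.stabilizer (G₀ k C H) V.cls) k,
            (∀ χ θ x, L χ (L θ x) = (γ.toFun χ θ : k) • L (χ * θ) x) ∧
            (∀ γ' : TwoCocycle (MulAction.stabilizer (G₀ k C H) V.cls) k,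
              (∀ χ θ x, L χ (L θ x) = (γ'.toFun χ θ : k) • L (χ * θ) x) → γ' = γ) ∧
            ((MulAction.stabilizer (G₀ k C H) V.cls : Set (G₀ k C H)).encard =
                (V.1.dim : ℕ∞) ^ 2 →
              Nonempty ((H ⧸ V.1.inflate.annihilator) ≃ₐ[k] TwistedGroupAlgebra γ) ∧
              Nonempty (TwistedGroupAlgebra γ ≃ₐ[k] Module.End k V.1.inflate) ∧
              Nonempty ((H ⧸ V.1.inflate.annihilator) ≃ₐ[k] Module.End k V.1.inflate)))) ∧
      -- (f)
      (IsBasicAlgebra k (IdentityFiber k C H) →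
        Function.Surjective ι ∧
        Nonempty (Irr k (Fiber H m)) ∧
        ∀ V W : Irr k (Fiber H m), ∃ χ : G₀ k C H, χ • V = W) := by
  have hinj : Function.Injective (algebraMap C H) := IsCentralHopfSubalgebra.injective k
  have hC : Algebra.FiniteType k C := finiteType_of_finite_of_injective k C H hinj
  obtain ⟨φ, hφ⟩ := exists_character k m
  have hfin : Module.Finite k (Fiber H m) := finite_fiber k H hφ
  have hfin₀ : Module.Finite k (IdentityFiber k C H) :=
    finite_fiber k H (φ := Bialgebra.counitAlgHom k C) rfl
  refine ⟨fun V W => ⟨AlgModule.exists_isQuotientOf hφ V W, AlgModule.exists_isSubmoduleOf hφ V W⟩,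
    fun χ => χ.irrModule.cls, G₀.mulActionIrr k H m,
    ⟨CharGroup.cls_irrModule_injective, CharGroup.cls_irrModule_eq_iff⟩,
    G₀.smul_cls_eq_iff, fun V => ?_, fun hb => ⟨?_, ?_, ?_⟩⟩
  · let := G₀.mulActionIrr k H m
    have hV : V.1.inflate.IsIrreducible := (AlgModule.isIrreducible_inflate_iff _).2 V.2
    have hVf : Module.Finite k V.1.inflate := V.2.finite
    have hVn : Nontrivial V.1.inflate := V.2.nontrivial
    have hS : V.1.inflate.IsStabilizer (MulAction.stabilizer (G₀ k C H) V.cls) :=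
      fun χ => G₀.smul_cls_eq_iff χ V V
    have hχV (χ : G₀ k C H) : (χ.toModule.tensor V.1.inflate).IsIrreducible :=
      (χ.tensor_iso_twistModule V.1).symm.isIrreducible
        ((AlgModule.isIrreducible_inflate_iff _).2 (χ.isIrreducible_twistModule V.2))
    have hcard : (MulAction.stabilizer (G₀ k C H) V.cls : Set (G₀ k C H)).encard =
        (V.1.dim : ℕ∞) ^ 2 ↔ Nat.card (MulAction.stabilizer (G₀ k C H) V.cls) =
          V.1.inflate.dim ^ 2 := hS.encard_eq_iff
    have hdim (χ : MulAction.stabilizer (G₀ k C H) V.cls) :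
        (G₀.toModule (χ : G₀ k C H)).dim = 1 := Module.finrank_self k
    have hne (χ θ : MulAction.stabilizer (G₀ k C H) V.cls) (h : χ ≠ θ) :
        ¬ (G₀.toModule (χ : G₀ k C H)).Iso (G₀.toModule (θ : G₀ k C H)) := fun hiso =>
      h (Subtype.ext (G₀.char_injective (AlgModule.ofCharacter_iso_iff.1 hiso)))
    have hcentral := AlgModule.inflate_hasCentralCharacter hφ V.1
    refine ⟨?_, hcard.trans ⟨fun h => ?_, ?_⟩, hcard.trans ⟨hS.tensor_dual_iso, fun h => ?_⟩, ?_,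
      fun L hL => ?_⟩
    · rw [hS.encard_eq]
      exact_mod_cast hS.card_le
    · exact ⟨_, _, hdim, hne, hS.tensor_dual_iso h⟩
    · rintro ⟨T, N, hN, hNne, h⟩
      exact hS.card_eq hV hχV hcentral N hN hNne h
    · exact hS.card_eq hV hχV hcentral _ hdim hne h
    · obtain ⟨L, hL⟩ := hS.exists_family
      exact ⟨L, AlgModule.isTwistedIsoFamily_iff.2 hL⟩
    · have hL' := AlgModule.isTwistedIsoFamily_iff.1 hL
      obtain ⟨γ, hγ, huniq⟩ := AlgModule.existsUnique_cocycle hV hL'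
      refine ⟨γ, hγ, huniq, fun h => ?_⟩
      obtain ⟨e₁⟩ := hS.nonempty_twistedGroupAlgebra_algEquiv (hcard.1 h) hL' hγ
      obtain ⟨e₂⟩ := hV.nonempty_quotient_annihilator_algEquiv
      exact ⟨⟨e₂.trans e₁.symm⟩, ⟨e₁⟩, ⟨e₂⟩⟩
  · intro M
    induction M using Quotient.inductionOn with
    | h M =>
      obtain ⟨χ, hχ⟩ := M.2.exists_ofCharacter_iso hb
      let ψ : G₀ k C H := WithConv.toConv χ
      exact ⟨ψ, (ψ.cls_irrModule_eq_iff M).2 hχ⟩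
  · have := nontrivial_fiber H hinj m
    exact AlgModule.nonempty_irr
  · intro V W
    induction V using Quotient.inductionOn with
    | h V =>
      induction W using Quotient.inductionOn with
      | h W =>
        obtain ⟨χ, hχ⟩ := exists_tensor_iso_of_isBasicAlgebra hφ hb V W
        exact ⟨χ, (G₀.smul_cls_eq_iff χ V W).2 hχ⟩
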